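/- All matroids are finite. Let $M$ be a matroid of rank $r$ with rank function $r(\cdot)$ on an $n$-element ground set $E$. Let $P(M)\subseteq\mathbb{R}^E$ be its matroid polytope, that is, the convex hull of the characteristic vectors of the bases of $M$, and let $\Delta(r,n)\subseteq\mathbb{R}^E$ be the hypersimplex, the convex hull of all $0,1$-vectors with exactly $r$ ones. A \emph{split} of a polytope $P$ is a collection $\mathcal{C}$ of polytopes such that: $\emptyset\in\mathcal{C}$; every vertex of a member of $\mathcal{C}$ is a vertex of $P$; every face of a member of $\mathcal{C}$ is in $\mathcal{C}$; the intersection of any two distinct members of $\mathcal{C}$ is a face of both; $\bigcup_{Q\in\mathcal{C}}Q=P$; and $\mathcal{C}$ has exactly two maximal members. The affine span of the intersection of the two maximal members is a \emph{split hyperplane} of $P$. For a flat $F$ of $M$ let $H(F)=\{x\in\mathbb{R}^E : \sum_{i\in F}x_i=r(F)\}$. The flat $F$ is a \emph{flacet} of $M$ if $H(F)\cap P(M)$ is a facet of $P(M)$ and $F$ is minimal under inclusion among the flats $F'$ with $H(F')\cap P(M)=H(F)\cap P(M)$. It is a \emph{split flacet} if, in addition, the affine span of $H(F)\cap\Delta(r,n)$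 is a split hyperplane of $\Delta(r,n)$. The matroid $M$ is a \emph{split matroid} if, for any two distinct split flacets $F_1,F_2$ of $M$, no point of $H(F_1)\cap H(F_2)$ lies in the relative interior of $A\cap[0,1]^E$, where $A$ is the affine span of $P(M)$. An \emph{excluded minor} for the class of split matroids is a matroid that is not a split matroid, but all of whose proper minors are split matroids. A matroid is \emph{connected} if any two distinct elements of its ground set lie in a common circuit, and \emph{disconnected} otherwise. Let $M(\mathcal{W}_2)$ be the cycle matroid of the graph $\mathcal{W}_2$ obtained from a triangle by adding one edge parallel to one of its edges (equivalently, $U_{2,3}$ with one element added in parallel to one of its elements), and let $S_0=M(\mathcal{W}_2)\oplus M(\mathcal{W}_2)$. \textbf{Proposition.} Up to isomorphism, $S_0$ is the only disconnected excluded minor for the class of split matroids. That is, a matroid $M$ is a disconnected excluded minor for the class of split matroids if and only if $M\cong S_0$. -/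

import Mathlib

open Set

noncomputable section

/-! ### Polytopes, faces, facets, splits -/

namespace SplitPolytope

variable {V : Type*} [AddCommGroup V] [Module ℝ V] [TopologicalSpace V]

/-- A polytope is the convex hull of a finite set of points. -/
def IsPolytope (P : Set V) : Prop := ∃ X : Set V, X.Finite ∧ P = convexHull ℝ X

/-- `G` is a face of the polytope `P`: it is empty, or it is the set of all points of `P` at which
some linear functional attains its maximum over `P`. Functionals that are constant on `P` give `P`
itself; the others give the intersections of `P` with supporting hyperplanes. -/
def IsFace (P G : Set V) : Prop := IsExposed ℝ P G

/-- A facet of `P` is a face, different from `P`, that is properly contained in no face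
other than `P`. -/
def IsFacet (P G : Set V) : Prop :=
  IsFace P G ∧ G ≠ P ∧ ∀ K : Set V, IsFace P K → G ⊂ K → K = P

/-- A collection `C` of polytopes is a split of the polytope `P`. -/
structure IsSplit (P : Set V) (C : Set (Set V)) : Prop where
  isPolytope : ∀ Q ∈ C, IsPolytope Q
  empty_mem : ∅ ∈ C
  vertices : ∀ Q ∈ C, Q.extremePoints ℝ ⊆ P.extremePoints ℝ
  faces : ∀ Q ∈ C, ∀ G, IsFace Q G → G ∈ C
  inter : ∀ Q₁ ∈ C, ∀ Q₂ ∈ C, Q₁ ≠ Q₂ → IsFace Q₁ (Q₁ ∩ Q₂) ∧ IsFace Q₂ (Q₁ ∩ Q₂)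
  sUnion_eq : ⋃₀ C = P
  two_maximal : {Q | Maximal (fun K => K ∈ C) Q}.encard = 2

/-- A split hyperplane of `P` is the affine span of the intersection of the two maximal cells
of a split of `P`. -/
def IsSplitHyperplane (P : Set V) (A : AffineSubspace ℝ V) : Prop :=
  ∃ C : Set (Set V), IsSplit P C ∧ ∃ Q₁ Q₂ : Set V, Q₁ ≠ Q₂ ∧
    Maximal (fun K => K ∈ C) Q₁ ∧ Maximal (fun K => K ∈ C) Q₂ ∧ A = affineSpan ℝ (Q₁ ∩ Q₂)

/-- The hypersimplex: the convex hull of the `0,1`-vectors with exactly `r` ones. -/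
def hypersimplex (r : ℕ) (ι : Type*) : Set (ι → ℝ) :=
  convexHull ℝ {x | ∃ S : Finset ι, S.card = r ∧ x = (S : Set ι).indicator 1}

end SplitPolytope

/-! ### Split matroids -/

namespace SplitMatroid

open SplitPolytope

variable {α β : Type*}

/-- The rank of a set in a (finite) matroid, as a natural number. -/
def rk (M : Matroid α) (F : Set α) : ℕ := (M.eRk F).toNat

/-- The matroid polytope `P(M)`, in the coordinate space indexed by the ground set: the convex hull
of the characteristic vectors of the bases. -/
def basePolytope (M : Matroid α) : Set (M.E → ℝ) :=
  convexHull ℝ {x | ∃ B : Set α, M.IsBase B ∧ x = ((↑) ⁻¹' B : Set M.E).indicator 1}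

/-- `H(F)`, the set of `x` such that the coordinates indexed by `F` add up to the rank of `F`. -/
def hyperplane (M : Matroid α) (F : Set α) : Set (M.E → ℝ) :=
  {x | ∑ᶠ i ∈ ((↑) ⁻¹' F : Set M.E), x i = (rk M F : ℝ)}

/-- `F` is a flacet of `M`: a flat such that `H(F)` cuts out a facet of the matroid polytope, and
minimal under inclusion among the flats that cut out this facet. -/
def IsFlacet (M : Matroid α) (F : Set α) : Prop :=
  M.IsFlat F ∧ IsFacet (basePolytope M) (hyperplane M F ∩ basePolytope M) ∧
    ∀ F' : Set α, M.IsFlat F' →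
      hyperplane M F' ∩ basePolytope M = hyperplane M F ∩ basePolytope M → F' ⊆ F → F' = F

/-- `F` is a split flacet of `M`: a flacet such that the intersection of `H(F)` with the
hypersimplex `Δ(r, n)` spans a split hyperplane of `Δ(r, n)`. -/
def IsSplitFlacet (M : Matroid α) (F : Set α) : Prop :=
  IsFlacet M F ∧ IsSplitHyperplane (hypersimplex (rk M M.E) M.E)
    (affineSpan ℝ (hyperplane M F ∩ hypersimplex (rk M M.E) M.E))

/-- `M` is a split matroid: for any two distinct split flacets `F₁`, `F₂`, no point of
`H(F₁) ∩ H(F₂)` is in the relative interior of the intersection of the unit cube with the affine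
span of the matroid polytope. -/
def IsSplitMatroid (M : Matroid α) : Prop :=
  ∀ F₁ F₂ : Set α, IsSplitFlacet M F₁ → IsSplitFlacet M F₂ → F₁ ≠ F₂ →
    ∀ x ∈ hyperplane M F₁ ∩ hyperplane M F₂,
      x ∉ intrinsicInterior ℝ
        ((affineSpan ℝ (basePolytope M) : Set (M.E → ℝ)) ∩ Set.Icc (0 : M.E → ℝ) 1)

/-- `M` is an excluded minor for the class of split matroids. -/
def IsExcludedMinor (M : Matroid α) : Prop :=
  ¬ IsSplitMatroid M ∧ ∀ N : Matroid α, N.IsStrictMinor M → IsSplitMatroid N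

/-- A matroid is connected if any two distinct elements lie in a common circuit. -/
def IsConnected (M : Matroid α) : Prop :=
  ∀ e ∈ M.E, ∀ f ∈ M.E, e ≠ f → ∃ C : Set α, M.IsCircuit C ∧ e ∈ C ∧ f ∈ C

/-- Isomorphism of matroids: a bijection between the ground sets that preserves independence
in both directions. -/
def Isomorphic (M : Matroid α) (N : Matroid β) : Prop :=
  ∃ f : M.E ≃ N.E, ∀ I : Set M.E,
    M.Indep ((↑) '' I : Set α) ↔ N.Indep ((↑) '' (f '' I) : Set β)

/-- The uniform matroid of rank at most `k` on a finite type. -/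
def uniform (k : ℕ) (ι : Type*) [Finite ι] : Matroid ι :=
  (IndepMatroid.ofFinite (E := Set.univ) Set.finite_univ (fun I => I.ncard ≤ k)
    (by simp)
    (fun _ J hJ hIJ => (Set.ncard_le_ncard hIJ (Set.toFinite J)).trans hJ)
    (fun I J _ hJ hlt => by
      obtain ⟨e, heJ, heI⟩ := Set.exists_mem_notMem_of_ncard_lt_ncard hlt (Set.toFinite I)
      refine ⟨e, heJ, heI, ?_⟩
      rw [Set.ncard_insert_of_notMem heI (Set.toFinite I)]
      omega)
    (fun _ _ => Set.subset_univ _)).matroid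

/-- `M(𝒲₂)`, the cycle matroid of the triangle with one extra parallel edge: `U_{2,3}` (the cycle
matroid of the triangle), with the elements `0` and `1` of `Fin 4` both placed at the same
element of `U_{2,3}`, so that they are parallel. -/
def MW2 : Matroid (Fin 4) := (uniform 2 (Fin 3)).comap ![0, 0, 1, 2]

/-- `S₀`, the direct sum of two copies of `M(𝒲₂)`. -/
def S0 : Matroid (Fin 4 ⊕ Fin 4) := MW2.sum MW2

end SplitMatroid

end

open scoped Matroid

namespace SplitMatroid

variable {α : Type*} {M : Matroid α} {F G S I J B : Set α}

/-! ### Rank, tight bases and separators -/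

/-! Polyhedral conditions are first turned into statements about bases. The vertices of `H(F) ∩
P(M)` are the bases tight on `F`, so flacets become `CombFlacet`s; a general face need not be of
this form, but the superlevel sets of its functional give enough sets `G` to compare with
(`tight_of_isMax`, `isFacet_of_combFacet`). A flacet with at least two nonloops always spans a split
hyperplane of the hypersimplex, and a flacet whose hyperplane meets the relative interior of the
slab has at least two nonloops. Hence the split condition can be dropped: `not_isSplitMatroid_iff`
asks only for two distinct flacets and a common interior point.

Let `M` be a disconnected excluded minor with a proper separator `S`. The nonloops of a flacet form
a connected restriction (`CombFlacet.eq_empty_or_eq`), so each of the two conflicting flacets lies,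
up to loops, in `S` or in its complement. If both lie on one side, the conflict survives restriction
to that side (`not_isSplitMatroid_restrict`), against minimality. If they lie on different sides,
each yields a minor `M(𝒲₂)` on its own side (`CombFlacet.exists_MW2`). As the sides are independent
of each other, the two minors combine to a minor `S₀`, which is itself not split, so it is all of
`M`.

Conversely, in `S₀` the two parallel pairs are flacets whose hyperplanes both contain the point with
all coordinates `1/2`. In a proper minor, a flacet with two nonloops needs at least four elements on
its side, so two such flacets must share a side. That side is then a copy of `M(𝒲₂)`, where both
equal the unique parallel pair up to loops. -/

lemma cast_rk (M : Matroid α) [M.RankFinite] (F : Set α) : ((rk M F : ℕ) : ℕ∞) = M.eRk F :=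
  ENat.natCast_toNat (Matroid.eRk_ne_top_iff.2 (M.isRkFinite_set F))

lemma ncard_eq_rk [M.Finite] (h : M.IsBasis I F) : I.ncard = rk M F := by
  rw [rk, ← h.encard_eq_eRk, Set.ncard]

lemma ncard_le_rk [M.Finite] (hI : M.Indep I) (h : I ⊆ F) : I.ncard ≤ rk M F := by
  have := hI.encard_le_eRk_of_subset h
  rw [← cast_rk, ← hI.finite.cast_ncard_eq] at this
  exact_mod_cast this

lemma isBasis_of_rk_le [M.Finite] (hI : M.Indep I) (h : I ⊆ F) (hF : F ⊆ M.E)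
    (hr : rk M F ≤ I.ncard) : M.IsBasis I F := by
  refine hI.isBasis_of_eRk_ge hI.finite h ?_
  rw [hI.eRk_eq_encard, ← cast_rk, ← hI.finite.cast_ncard_eq]
  exact_mod_cast hr

/-- The base `B` meets `F` in as many elements as possible. -/
def Tight (M : Matroid α) (F B : Set α) : Prop := (B ∩ F).ncard = rk M F

lemma ncard_inter_le_rk [M.Finite] (hB : M.IsBase B) : (B ∩ F).ncard ≤ rk M F :=
  ncard_le_rk (hB.indep.inter_right F) inter_subset_right

lemma Tight.isBasis [M.Finite] (h : Tight M F B) (hB : M.IsBase B) (hF : F ⊆ M.E) :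
    M.IsBasis (B ∩ F) F :=
  isBasis_of_rk_le (hB.indep.inter_right F) inter_subset_right hF h.ge

lemma exists_tight [M.Finite] (hF : F ⊆ M.E) : ∃ B, M.IsBase B ∧ Tight M F B := by
  obtain ⟨I, hI⟩ := M.exists_isBasis F
  obtain ⟨B, hB, rfl⟩ := hI.exists_isBase
  exact ⟨B, hB, ncard_eq_rk hI⟩

lemma ncard_inter_add_diff [M.Finite] (hI : M.Indep I) (G : Set α) :
    (I ∩ G).ncard + (I \ G).ncard = I.ncard := by
  exact ncard_inter_add_ncard_sdiff_eq_ncard I G hI.finite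

/-- In the restriction of `M` to `F`, the set `G` is a union of components. -/
def Splits (M : Matroid α) (F G : Set α) : Prop :=
  ∀ ⦃I J : Set α⦄, M.Indep I → M.Indep J → I ⊆ G → J ⊆ F → Disjoint J G → M.Indep (I ∪ J)

lemma Splits.compl (h : Splits M F G) : Splits M F (F \ G) := by
  intro I J hI hJ hIG hJF hd
  rw [union_comm]
  refine h hJ hI (fun x hx => ?_) (hIG.trans sdiff_subset) (disjoint_left.2 fun x hx => (hIG hx).2)
  by_contra hxG
  exact hd.le_bot ⟨hx, hJF hx, hxG⟩

/-- Replacing `B ∩ G` by a basis `I` of `G` inside `B ∩ F` keeps independence. Since `B ∩ F` already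
has the rank of `F`, `I` cannot be larger than `B ∩ G`. -/
lemma Splits.tight [M.Finite] (h : Splits M F G) (hG : G ⊆ F) (hF : F ⊆ M.E) (hB : M.IsBase B)
    (hT : Tight M F B) : Tight M G B := by
  refine le_antisymm (ncard_inter_le_rk hB) ?_
  obtain ⟨I, hI⟩ := M.exists_isBasis G (hG.trans hF)
  have hd : Disjoint ((B ∩ F) \ G) G := disjoint_sdiff_left
  have hind := h hI.indep ((hB.indep.inter_right F).sdiff G) hI.subset
    (sdiff_subset.trans inter_subset_right) hd
  have h1 := ncard_le_rk hind (F := F)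
    (union_subset (hI.subset.trans hG) (sdiff_subset.trans inter_subset_right))
  rw [ncard_union_eq (hd.symm.mono_left hI.subset) hI.indep.finite
    (((hB.indep.inter_right F).sdiff G).finite), ← hT, ncard_eq_rk hI,
    ← ncard_inter_add_diff (hB.indep.inter_right F) G, inter_assoc,
    inter_eq_self_of_subset_right hG] at h1
  omega

/-- An independent `J` disjoint from `S` extends to a base, which spans `S` by tightness, so `J` is
independent in `M ／ S`. This no longer depends on the basis chosen for `S`, so any independent
subset of `S` can be joined to `J`. -/
lemma splits_of_tight [M.Finite] (hS : S ⊆ M.E) (h : ∀ B, M.IsBase B → Tight M S B) :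
    Splits M M.E S := by
  intro I J hI hJ hIS _ hd
  obtain ⟨B, hB, hJB⟩ := hJ.exists_isBase_superset
  obtain ⟨I', hI', hII'⟩ := hI.subset_isBasis_of_subset hIS hS
  have hb := (h B hB).isBasis hB hS
  have h1 : (M ／ S).Indep J := hb.contract_indep_iff.2
    ⟨hB.indep.subset (union_subset hJB inter_subset_left), hd.symm⟩
  have h2 := (hI'.contract_indep_iff.1 h1).1
  exact h2.subset (union_subset (hII'.trans subset_union_right) subset_union_left)

/-- Combinatorial form of "`H(F)` cuts out a facet of the matroid polytope". -/
def CombFacet (M : Matroid α) (F : Set α) : Prop :=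
  (∃ B, M.IsBase B ∧ ¬ Tight M F B) ∧ ∀ G ⊆ M.E,
    (∀ B, M.IsBase B → Tight M F B → Tight M G B) →
      (∀ B, M.IsBase B → Tight M G B → Tight M F B) ∨ ∀ B, M.IsBase B → Tight M G B

/-- Combinatorial form of being a flacet. -/
structure CombFlacet (M : Matroid α) (F : Set α) : Prop where
  isFlat : M.IsFlat F
  facet : CombFacet M F
  minimal : ∀ F', M.IsFlat F' → (∀ B, M.IsBase B → (Tight M F' B ↔ Tight M F B)) → F' ⊆ F → F' = F

/-- The facet of `F` lies in the faces of both `G` and `F \ G`. A face containing a facet is the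
facet or everything, and the case where both faces equal the facet makes `G` a separator of the
whole matroid. -/
lemma CombFacet.tight_or_tight_diff [M.Finite] (hF : CombFacet M F) (hFE : F ⊆ M.E) (hG : G ⊆ F)
    (h : Splits M F G) :
    (∀ B, M.IsBase B → Tight M G B) ∨ ∀ B, M.IsBase B → Tight M (F \ G) B := by
  have hGE := hG.trans hFE
  have h1 := hF.2 G hGE fun B hB hT => h.tight hG hFE hB hT
  have h2 := hF.2 (F \ G) (sdiff_subset.trans hFE)
    fun B hB hT => h.compl.tight sdiff_subset hFE hB hT
  rcases h1 with h1 | h1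
  swap; · exact Or.inl h1
  rcases h2 with h2 | h2
  swap; · exact Or.inr h2
  left
  -- `B` is chosen to span both `F \ G` and `E \ G`. The first makes it tight on `F`, hence on `G`,
  -- so `r(G) + r(E \ G) = r(M)`; this bounds `B₂ ∩ G` from below for every base `B₂`.
  obtain ⟨I', hI'⟩ := M.exists_isBasis (F \ G) (sdiff_subset.trans hFE)
  obtain ⟨I, hI, hI'I⟩ := hI'.indep.subset_isBasis_of_subset (X := M.E \ G)
    (hI'.subset.trans (sdiff_subset_sdiff_left hFE)) sdiff_subset
  obtain ⟨B, hB, rfl⟩ := hI.exists_isBase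
  have ht : Tight M (F \ G) B := by
    refine le_antisymm (ncard_inter_le_rk hB) ?_
    rw [← ncard_eq_rk hI']
    exact ncard_le_ncard (subset_inter (hI'I.trans inter_subset_left) hI'.subset)
      (hB.indep.finite.subset inter_subset_left)
  have hGB : Tight M G B := h.tight hG hFE hB (h2 B hB ht)
  intro B₂ hB₂
  refine le_antisymm (ncard_inter_le_rk hB₂) ?_
  have e1 := ncard_inter_add_diff hB.indep G
  have e2 := ncard_inter_add_diff hB₂.indep G
  have e3 := hB.ncard_eq_ncard_of_isBase hB₂
  have e4 : B ∩ (M.E \ G) = B \ G := by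
    rw [← inter_sdiff_assoc, inter_eq_self_of_subset_left hB.subset_ground]
  have e5 := ncard_eq_rk hI
  have e6 : (B₂ \ G).ncard ≤ rk M (M.E \ G) :=
    ncard_le_rk (hB₂.indep.sdiff G) (sdiff_subset_sdiff_left hB₂.subset_ground)
  rw [e4] at e5
  unfold Tight at hGB
  omega

/-- Such a `G` is a separator, so deleting it from `F` and putting the loops back leaves a flat that
cuts out the same face. Minimality of `F` then leaves only loops in `G`. -/
lemma CombFlacet.subset_loops [M.Finite] (hF : CombFlacet M F) (hG : G ⊆ F)
    (h : ∀ B, M.IsBase B → Tight M G B) : G ⊆ M.loops := by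
  have hFE := hF.isFlat.subset_ground
  have hs := splits_of_tight (hG.trans hFE) h
  have hLF := hF.isFlat.loops_subset
  have hflat : M.IsFlat ((F \ G) ∪ M.loops) := by
    rw [Matroid.isFlat_iff_closure_eq]
    refine subset_antisymm (fun e he => ?_)
      (M.subset_closure _ (union_subset (sdiff_subset.trans hFE) M.loops_subset_ground))
    rw [← Matroid.closure_empty, Matroid.closure_union_closure_right_eq, union_empty] at he
    by_contra hcon
    simp only [mem_union, not_or] at hcon
    have heF : e ∈ F := by
      have := M.closure_subset_closure (sdiff_subset : F \ G ⊆ F) he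
      rwa [hF.isFlat.closure] at this
    have heG : e ∈ G := by by_contra h'; exact hcon.1 ⟨heF, h'⟩
    have henl : M.Indep {e} := by
      rw [Matroid.indep_singleton]
      exact (M.isNonloop_iff_notMem_loops (hFE heF)).2 hcon.2
    obtain ⟨J, hJ⟩ := M.exists_isBasis (F \ G) (sdiff_subset.trans hFE)
    have hd : Disjoint J G := disjoint_left.2 fun x hx => (hJ.subset hx).2
    have hi := hs henl hJ.indep (singleton_subset_iff.2 heG) hJ.indep.subset_ground hd
    rw [← hJ.closure_eq_closure, hJ.indep.mem_closure_iff'] at he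
    exact hd.le_bot ⟨he.2 (by rwa [← singleton_union]), heG⟩
  have := hF.minimal _ hflat (fun B hB => ?_) (union_subset sdiff_subset hLF)
  · intro x hx
    rw [← this] at hG
    rcases hG hx with h' | h'
    · exact absurd hx h'.2
    · exact h'
  · obtain ⟨B₀, hB₀, hT₀⟩ := exists_tight (M := M) hFE
    have hT₁ : Tight M (F \ G) B₀ := by
      refine Splits.tight (F := F) ?_ sdiff_subset hFE hB₀ hT₀
      exact Splits.compl (fun I J hI hJ h1 h2 h3 => hs hI hJ h1 hJ.subset_ground h3)
    have key : ∀ {B}, M.IsBase B → B ∩ (F \ G ∪ M.loops) = B ∩ (F \ G) := by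
      intro B hB
      have := hB.indep.disjoint_loops
      rw [inter_union_distrib_left, this.inter_eq, union_empty]
    have hr : rk M (F \ G ∪ M.loops) = rk M (F \ G) := by
      unfold rk
      rw [← Matroid.closure_empty, Matroid.eRk_union_closure_right_eq, union_empty]
    have e : ∀ {B}, M.IsBase B → (B ∩ (F \ G)).ncard + (B ∩ G).ncard = (B ∩ F).ncard := by
      intro B hB
      rw [← ncard_inter_add_diff (hB.indep.inter_right F) G, inter_assoc,
        inter_eq_self_of_subset_right hG, add_comm, inter_sdiff_assoc]
    have a1 := e hB
    have a2 := e hB₀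
    have a3 := h B hB
    have a4 := h B₀ hB₀
    unfold Tight at *
    rw [key hB, hr]
    omega

/-- Connectedness of a flacet without its loops. It confines the flacet to one side of any separator
and rules out coloops in its restriction. -/
lemma CombFlacet.eq_empty_or_eq [M.Finite] (hF : CombFlacet M F) (hG : G ⊆ F \ M.loops)
    (h : Splits M (F \ M.loops) G) : G = ∅ ∨ G = F \ M.loops := by
  have hGF := hG.trans sdiff_subset
  have hs : Splits M F G := fun I J hI hJ h1 h2 h3 => h hI hJ h1
    (fun x hx => ⟨h2 hx, fun hl => hJ.disjoint_loops.le_bot ⟨hx, hl⟩⟩) h3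
  rcases hF.facet.tight_or_tight_diff hF.isFlat.subset_ground hGF hs with h | h
  · left
    have := hF.subset_loops hGF h
    exact eq_empty_of_forall_notMem fun x hx => (hG hx).2 (this hx)
  · right
    have := hF.subset_loops sdiff_subset h
    refine subset_antisymm hG fun x hx => ?_
    by_contra hxG
    exact hx.2 (this ⟨hx.1, hxG⟩)

lemma CombFlacet.subset_or_disjoint [M.Finite] (hF : CombFlacet M F) (hS : Splits M M.E S) :
    F \ M.loops ⊆ S ∨ Disjoint (F \ M.loops) S := by
  rcases hF.eq_empty_or_eq (G := (F \ M.loops) ∩ S) inter_subset_left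
    (fun I J hI hJ h1 h2 h3 => hS hI hJ (h1.trans inter_subset_right) hJ.subset_ground
      (disjoint_left.2 fun x hx hxS => h3.le_bot ⟨hx, h2 hx, hxS⟩)) with h | h
  · right; exact disjoint_iff_inter_eq_empty.2 h
  · left; exact inter_eq_left.1 h

lemma CombFlacet.mem_closure [M.Finite] (hF : CombFlacet M F) (hnt : (F \ M.loops).Nontrivial)
    {a : α} (ha : a ∈ F \ M.loops) : a ∈ M.closure ((F \ M.loops) \ {a}) := by
  by_contra hcon
  have haE := hF.isFlat.subset_ground ha.1
  have hsp : Splits M (F \ M.loops) {a} := by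
    intro I J hI hJ h1 h2 h3
    rcases subset_singleton_iff_eq.1 h1 with rfl | rfl
    · simpa using hJ
    · rw [singleton_union, hJ.insert_indep_iff]
      have hJa : J ⊆ (F \ M.loops) \ {a} := subset_sdiff.2 ⟨h2, h3⟩
      exact Or.inl ⟨haE, fun h => hcon (M.closure_subset_closure hJa h)⟩
  rcases hF.eq_empty_or_eq (singleton_subset_iff.2 ha) hsp with h | h
  · simp at h
  · rw [← h] at hnt; simp at hnt

/-! ### Minors isomorphic to `M(𝒲₂)` -/

/-- Independence in `M(𝒲₂)`. -/
def MW2Indep (J : Set (Fin 4)) : Prop :=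
  ¬ (0 ∈ J ∧ 1 ∈ J) ∧ ¬ (0 ∈ J ∧ 2 ∈ J ∧ 3 ∈ J) ∧ ¬ (1 ∈ J ∧ 2 ∈ J ∧ 3 ∈ J)

lemma MW2Indep.subset_cases {J : Set (Fin 4)} (h : MW2Indep J) :
    J ⊆ {0, 2} ∨ J ⊆ {0, 3} ∨ J ⊆ {1, 2} ∨ J ⊆ {1, 3} ∨ J ⊆ {2, 3} := by
  simp only [MW2Indep, subset_def, Fin.forall_fin_succ] at *
  simp at *
  tauto

/-- As `F` is not a separator, some circuit `K` of `M ／ F` is independent in `M`. Two elements of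
`K` serve as the series pair and two elements `a`, `b` of `F` as the parallel pair; contracting `Z`,
the rest of `K` and of a basis of `F`, leaves `M(𝒲₂)` on them. -/
lemma CombFlacet.exists_MW2 [M.Finite] (hF : CombFlacet M F) (hnt : (F \ M.loops).Nontrivial)
    (hS : Splits M M.E S) (hFS : F \ M.loops ⊆ S) :
    ∃ (g : Fin 4 → α) (Z : Set α), Function.Injective g ∧ range g ⊆ S ∩ M.E ∧ Z ⊆ S ∩ M.E ∧
      Disjoint Z (range g) ∧ g 0 ∈ F \ M.loops ∧ g 1 ∈ F \ M.loops ∧ g 2 ∉ F ∧ g 3 ∉ F ∧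
      ∀ J : Set (Fin 4), M.Indep (g '' J ∪ Z) ↔ MW2Indep J := by
  have hFE := hF.isFlat.subset_ground
  obtain ⟨J, hJS, hJF, hJ, hJN⟩ :
      ∃ J, J ⊆ S ∧ Disjoint J F ∧ M.Indep J ∧ ¬ (M ／ F).Indep J := by
    obtain ⟨B, hB, hBT⟩ := hF.facet.1
    obtain ⟨B₁, hB₁, hT₁⟩ := exists_tight (M := M) subset_rfl
    have hBE : Tight M M.E B := by
      unfold Tight at *
      rw [← hT₁, inter_eq_self_of_subset_left hB.subset_ground,
        inter_eq_self_of_subset_left hB₁.subset_ground, hB.ncard_eq_ncard_of_isBase hB₁]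
    have hns : ¬ Splits M M.E F := fun h => hBT (h.tight hFE subset_rfl hB hBE)
    unfold Splits at hns
    push Not at hns
    obtain ⟨I, J, hI, hJ, hIF, -, hd, hIJ⟩ := hns
    -- Cutting `J` down to `S` keeps it dependent in `M ／ F`: otherwise it could be joined to a
    -- basis of `F`, which lies in `S`, and then `J \ S` could be added across the separator.
    refine ⟨J ∩ S, inter_subset_right, hd.mono_left inter_subset_left, hJ.inter_right S, ?_⟩
    intro hN
    obtain ⟨I', hI', hII'⟩ := hI.subset_isBasis_of_subset hIF hFE
    have h1 := (hI'.contract_indep_iff.1 hN).1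
    have hI'S : I' ⊆ S := fun x hx => hFS
      ⟨hI'.subset hx, fun hl => hI'.indep.disjoint_loops.le_bot ⟨hx, hl⟩⟩
    have h2 := hS h1 (hJ.sdiff S) (union_subset inter_subset_right hI'S)
      (sdiff_subset.trans hJ.subset_ground) disjoint_sdiff_left
    refine hIJ (h2.subset (union_subset (hII'.trans (subset_union_right.trans
      subset_union_left)) fun x hx => ?_))
    by_cases hxS : x ∈ S
    · exact Or.inl (Or.inl ⟨hx, hxS⟩)
    · exact Or.inr ⟨hx, hxS⟩
  obtain ⟨K, hKJ, hK⟩ := Matroid.Dep.exists_isCircuit_subset (M := M ／ F) (X := J)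
    ⟨hJN, fun x hx => ⟨hJ.subset_ground hx, fun h => hJF.le_bot ⟨hx, h⟩⟩⟩
  have hKF : Disjoint F K := (hJF.mono_left hKJ).symm
  have hKM : M.Indep K := hJ.subset hKJ
  have hKS := hKJ.trans hJS
  obtain ⟨I, hI⟩ := M.exists_isBasis F
  have hcirc : ∀ {I'}, M.IsBasis I' F → ¬ M.Indep (K ∪ I') := fun h h' =>
    hK.not_indep (h.contract_indep_iff.2 ⟨h', hKF⟩)
  have hcirc' : ∀ {I'}, M.IsBasis I' F → ∀ c ∈ K, M.Indep (K \ {c} ∪ I') := fun h c hc =>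
    (h.contract_indep_iff.1 (hK.sdiff_singleton_indep hc)).1
  -- A singleton circuit would be a loop of `M ／ F`, that is, an element of the closure of the flat
  -- `F` outside `F`.
  have hKnt : K.Nontrivial := by
    rw [← not_subsingleton_iff]
    intro hsub
    obtain ⟨c, hc⟩ := hK.nonempty
    have hKc : K = {c} := hsub.eq_singleton_of_mem hc
    have hcF : c ∉ F := fun h => hKF.le_bot ⟨h, hc⟩
    have hcE := hKM.subset_ground hc
    have := hcirc hI
    rw [hKc, singleton_union, hI.indep.insert_indep_iff] at this
    push Not at this
    refine this.1 ⟨hcE, fun h => hcF ?_⟩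
    rwa [hI.closure_eq_closure, hF.isFlat.closure] at h
  obtain ⟨c, hc, d, hd, hcd⟩ := hKnt
  obtain ⟨X, hX, hKX⟩ := hKM.subset_isBasis_of_subset (X := K ∪ I) subset_union_left
    (union_subset hKM.subset_ground hI.indep.subset_ground)
  obtain ⟨a, haI, haX⟩ : ∃ a ∈ I, a ∉ X := by
    by_contra! h
    exact hcirc hI (hX.indep.subset (union_subset hKX h))
  have hIK : Disjoint I K := hKF.mono_left hI.subset
  have haK : a ∉ K := fun h => hIK.le_bot ⟨haI, h⟩
  -- `K ∪ I` has rank one less than its size, because removing `c` makes it independent. So the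
  -- basis `X`, which avoids `a`, must be everything but `a`.
  have hKIa : M.Indep ((K ∪ I) \ {a}) := by
    have hfin : (K ∪ I).Finite := hKM.finite.union hI.indep.finite
    have h1 : X ⊆ (K ∪ I) \ {a} := subset_sdiff_singleton hX.subset haX
    have h2 := ncard_le_rk (F := K ∪ I) (hcirc' hI c hc) (union_subset_union_left _ sdiff_subset)
    have h3 : K \ {c} ∪ I = (K ∪ I) \ {c} := by
      rw [union_sdiff_distrib, sdiff_singleton_eq_self (fun h => hIK.le_bot ⟨h, hc⟩)]
    have hcKI : c ∈ K ∪ I := Or.inl hc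
    have haKI : a ∈ K ∪ I := Or.inr haI
    rw [h3, ncard_sdiff_singleton_of_mem hcKI, ← ncard_eq_rk hX,
      ← ncard_sdiff_singleton_of_mem haKI] at h2
    rw [← eq_of_subset_of_ncard_le h1 h2 hfin.sdiff]
    exact hX.indep
  have haL : a ∈ F \ M.loops :=
    ⟨hI.subset haI, fun hl => hI.indep.disjoint_loops.le_bot ⟨haI, hl⟩⟩
  have hacl : a ∉ M.closure (I \ {a}) := hI.indep.notMem_closure_sdiff_of_mem haI
  -- `a` is not a coloop of the restriction to the nonloops of `F`, so these do not all lie, apart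
  -- from `a`, in the hyperplane of `F` spanned by `I \ {a}`. Then `b` can replace `a` in the basis
  -- `I`.
  obtain ⟨b, hbF, hbcl⟩ : ∃ b ∈ (F \ M.loops) \ {a}, b ∉ M.closure (I \ {a}) := by
    by_contra! h
    exact hacl (M.closure_subset_closure_of_subset_closure h (hF.mem_closure hnt haL))
  have hbE : b ∈ M.E := hFE hbF.1.1
  have hba : b ≠ a := hbF.2
  have hbI : b ∉ I := fun h => hbcl (M.mem_closure_of_mem' ⟨h, hba⟩ hbE)
  have hI' : M.IsBasis (insert b (I \ {a})) F := by
    refine isBasis_of_rk_le ?_ ?_ hFE ?_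
    · rw [(hI.indep.sdiff {a}).insert_indep_iff]; exact Or.inl ⟨hbE, hbcl⟩
    · exact insert_subset hbF.1.1 (sdiff_subset.trans hI.subset)
    · rw [ncard_insert_of_notMem (fun h => hbI h.1) hI.indep.finite.sdiff,
        ncard_sdiff_singleton_add_one haI hI.indep.finite, ncard_eq_rk hI]
  have hIS : I ⊆ S := fun x hx => hFS
    ⟨hI.subset hx, fun hl => hI.indep.disjoint_loops.le_bot ⟨hx, hl⟩⟩
  have hcF : c ∉ F := fun h => hKF.le_bot ⟨h, hc⟩
  have hdF : d ∉ F := fun h => hKF.le_bot ⟨h, hd⟩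
  have haF := haL.1
  have hbF' := hbF.1.1
  have hac : a ≠ c := fun h => hcF (h ▸ haF)
  have had : a ≠ d := fun h => hdF (h ▸ haF)
  have hbc : b ≠ c := fun h => hcF (h ▸ hbF')
  have hbd : b ≠ d := fun h => hdF (h ▸ hbF')
  refine ⟨![a, b, c, d], (I \ {a}) ∪ (K \ {c, d}), ?_, ?_, ?_, ?_, haL, hbF.1, hcF, hdF, ?_⟩
  · intro i j
    fin_cases i <;> fin_cases j <;> simp [*, hba.symm, hac.symm, had.symm, hbc.symm, hbd.symm,
      hcd.symm]
  · rintro _ ⟨i, rfl⟩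
    fin_cases i
    · exact ⟨hFS haL, hFE haF⟩
    · exact ⟨hFS hbF.1, hbE⟩
    · exact ⟨hKS hc, hKM.subset_ground hc⟩
    · exact ⟨hKS hd, hKM.subset_ground hd⟩
  · exact union_subset (subset_inter (sdiff_subset.trans hIS)
      (sdiff_subset.trans hI.indep.subset_ground))
      (subset_inter (sdiff_subset.trans hKS) (sdiff_subset.trans hKM.subset_ground))
  · rw [disjoint_right]
    rintro _ ⟨i, rfl⟩
    fin_cases i
    · simp [haK]
    · have : b ∉ K := fun h => hKF.le_bot ⟨hbF', h⟩
      simp [hbI, this]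
    · have : c ∉ I := fun h => hcF (hI.subset h)
      simp [this]
    · have : d ∉ I := fun h => hdF (hI.subset h)
      simp [this]
  · intro T
    have hmem : ∀ i ∈ T, ∀ x, ![a, b, c, d] i = x → x ∈ ![a, b, c, d] '' T :=
      fun i hi x hx => ⟨i, hi, hx⟩
    constructor
    · intro h
      refine ⟨fun ⟨h0, h1⟩ => ?_, fun ⟨h0, h2, h3⟩ => ?_, fun ⟨h1, h2, h3⟩ => ?_⟩
      · have h0 := hmem 0 h0 a rfl
        have h1 := hmem 1 h1 b rfl
        refine hbI (hI.mem_of_insert_indep hbF' (h.subset (insert_subset (Or.inl h1) ?_)))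
        intro x hx
        by_cases hxa : x = a
        · rw [hxa]; exact Or.inl h0
        · exact Or.inr (Or.inl ⟨hx, hxa⟩)
      · have h0 := hmem 0 h0 a rfl
        have h2 := hmem 2 h2 c rfl
        have h3 := hmem 3 h3 d rfl
        refine hcirc hI (h.subset ?_)
        rintro x (hx | hx)
        · by_cases hxc : x = c
          · rw [hxc]; exact Or.inl h2
          by_cases hxd : x = d
          · rw [hxd]; exact Or.inl h3
          exact Or.inr (Or.inr ⟨hx, by simp [hxc, hxd]⟩)
        · by_cases hxa : x = a
          · rw [hxa]; exact Or.inl h0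
          · exact Or.inr (Or.inl ⟨hx, hxa⟩)
      · have h1 := hmem 1 h1 b rfl
        have h2 := hmem 2 h2 c rfl
        have h3 := hmem 3 h3 d rfl
        refine hcirc hI' (h.subset ?_)
        rintro x (hx | hx | hx)
        · by_cases hxc : x = c
          · rw [hxc]; exact Or.inl h2
          by_cases hxd : x = d
          · rw [hxd]; exact Or.inl h3
          exact Or.inr (Or.inr ⟨hx, by simp [hxc, hxd]⟩)
        · rw [hx]; exact Or.inl h1
        · exact Or.inr (Or.inl hx)
    · intro h
      have hKc : K \ {c, d} ⊆ K \ {c} := sdiff_subset_sdiff_right (by simp)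
      have hKd : K \ {c, d} ⊆ K \ {d} := sdiff_subset_sdiff_right (by simp)
      rcases h.subset_cases with h | h | h | h | h
      · refine (hcirc' hI d hd).subset (union_subset ((image_mono h).trans ?_) ?_)
        · simp only [image_insert_eq, image_singleton]
          exact insert_subset (Or.inr haI) (singleton_subset_iff.2 (Or.inl ⟨hc, hcd⟩))
        · exact union_subset (sdiff_subset.trans subset_union_right)
            (hKd.trans subset_union_left)
      · refine (hcirc' hI c hc).subset (union_subset ((image_mono h).trans ?_) ?_)
        · simp only [image_insert_eq, image_singleton]
          exact insert_subset (Or.inr haI) (singleton_subset_iff.2 (Or.inl ⟨hd, hcd.symm⟩))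
        · exact union_subset (sdiff_subset.trans subset_union_right)
            (hKc.trans subset_union_left)
      · refine (hcirc' hI' d hd).subset (union_subset ((image_mono h).trans ?_) ?_)
        · simp only [image_insert_eq, image_singleton]
          exact insert_subset (Or.inr (Or.inl rfl)) (singleton_subset_iff.2 (Or.inl ⟨hc, hcd⟩))
        · exact union_subset ((subset_insert _ _).trans subset_union_right)
            (hKd.trans subset_union_left)
      · refine (hcirc' hI' c hc).subset (union_subset ((image_mono h).trans ?_) ?_)
        · simp only [image_insert_eq, image_singleton]
          exact insert_subset (Or.inr (Or.inl rfl))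
            (singleton_subset_iff.2 (Or.inl ⟨hd, hcd.symm⟩))
        · exact union_subset ((subset_insert _ _).trans subset_union_right)
            (hKc.trans subset_union_left)
      · refine hKIa.subset (union_subset ((image_mono h).trans ?_) ?_)
        · simp only [image_insert_eq, image_singleton]
          exact insert_subset ⟨Or.inl hc, hac.symm⟩
            (singleton_subset_iff.2 ⟨Or.inl hd, had.symm⟩)
        · exact union_subset (sdiff_subset_sdiff_left subset_union_right)
            fun x hx => ⟨Or.inl hx.1, fun h => haK (h ▸ hx.1)⟩

/-! ### Disconnected matroids -/

/-- Transitivity of lying in a common circuit, by induction on the size of `C₁ ∪ C₂`. Strong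
elimination at a common element `p` gives circuits `C₃ ∋ e` and `C₄ ∋ q` avoiding `p`, and one of
three new intersecting pairs has a smaller union. -/
lemma exists_isCircuit_of_inter_nonempty [M.Finite] {e q : α} (n : ℕ) :
    ∀ C₁ C₂ : Set α, M.IsCircuit C₁ → M.IsCircuit C₂ → e ∈ C₁ → q ∈ C₂ →
      (C₁ ∩ C₂).Nonempty → (C₁ ∪ C₂).ncard = n → ∃ C, M.IsCircuit C ∧ e ∈ C ∧ q ∈ C := by
  induction n using Nat.strong_induction_on with
  | _ n ih =>
  intro C₁ C₂ h₁ h₂ he hq ⟨p, hp₁, hp₂⟩ hn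
  by_cases he₂ : e ∈ C₂
  · exact ⟨C₂, h₂, he₂, hq⟩
  by_cases hq₁ : q ∈ C₁
  · exact ⟨C₁, h₁, he, hq₁⟩
  have hfin : (C₁ ∪ C₂).Finite := h₁.finite.union h₂.finite
  obtain ⟨C₃, hC₃s, h₃, he₃⟩ := h₁.strong_elimination h₂ hp₁ hp₂ he he₂
  obtain ⟨C₄, hC₄s, h₄, hq₄⟩ := h₂.strong_elimination h₁ hp₂ hp₁ hq hq₁
  rw [union_comm] at hC₄s
  obtain ⟨y, hy₃, hy₁⟩ : ∃ y ∈ C₃, y ∉ C₁ := by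
    by_contra! h
    have := h₃.eq_of_subset_isCircuit h₁ h
    rw [← this] at hp₁
    exact (hC₃s hp₁).2 rfl
  have hy₂ : y ∈ C₂ := (hC₃s hy₃).1.resolve_left hy₁
  obtain ⟨z, hz₄, hz₂⟩ : ∃ z ∈ C₄, z ∉ C₂ := by
    by_contra! h
    have := h₄.eq_of_subset_isCircuit h₂ h
    rw [← this] at hp₂
    exact (hC₄s hp₂).2 rfl
  have hz₁ : z ∈ C₁ := (hC₄s hz₄).1.resolve_right hz₂
  by_cases h3 : C₃ ∪ C₂ ⊂ C₁ ∪ C₂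
  · exact ih _ (hn ▸ ncard_lt_ncard h3 hfin) C₃ C₂ h₃ h₂ he₃ hq ⟨y, hy₃, hy₂⟩ rfl
  by_cases h4 : C₁ ∪ C₄ ⊂ C₁ ∪ C₂
  · exact ih _ (hn ▸ ncard_lt_ncard h4 hfin) C₁ C₄ h₁ h₄ he hq₄ ⟨z, hz₁, hz₄⟩ rfl
  -- If replacing `C₂` by `C₄` does not shrink the union, `C₄` contains `C₂ \ C₁`, hence `y`. So
  -- `C₃` and `C₄` meet, and their union misses `p`.
  have h4' : C₁ ∪ C₄ = C₁ ∪ C₂ := by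
    by_contra h
    exact h4 ((union_subset subset_union_left (hC₄s.trans sdiff_subset)).ssubset_of_ne h)
  have hy₄ : y ∈ C₄ := by
    have : y ∈ C₁ ∪ C₄ := h4' ▸ Or.inr hy₂
    exact this.resolve_left hy₁
  have h5 : C₃ ∪ C₄ ⊂ C₁ ∪ C₂ := by
    refine (union_subset hC₃s hC₄s).trans_ssubset ?_
    exact sdiff_singleton_ssubset.2 (Or.inl hp₁)
  exact ih _ (hn ▸ ncard_lt_ncard h5 hfin) C₃ C₄ h₃ h₄ he₃ hq₄ ⟨y, hy₃, hy₄⟩ rfl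

lemma exists_splits_of_not_isConnected [M.Finite] (h : ¬ IsConnected M) :
    ∃ S ⊆ M.E, S.Nonempty ∧ S ≠ M.E ∧ Splits M M.E S := by
  unfold IsConnected at h
  push Not at h
  obtain ⟨e, he, f, hf, hef, hef'⟩ := h
  -- `S` is the component of `e`. A circuit meeting both `S` and its complement would put an outside
  -- element in a common circuit with `e`.
  set S : Set α := {x | x ∈ M.E ∧ (x = e ∨ ∃ C, M.IsCircuit C ∧ e ∈ C ∧ x ∈ C)} with hS
  refine ⟨S, fun x hx => hx.1, ⟨e, he, Or.inl rfl⟩, fun h => ?_, ?_⟩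
  · rcases (h ▸ hf : f ∈ S).2 with h | ⟨C, h1, h2, h3⟩
    · exact hef h.symm
    · exact hef' C h1 h2 h3
  · intro I J hI hJ hIS _ hd
    by_contra hcon
    obtain ⟨C, hCs, hC⟩ := Matroid.Dep.exists_isCircuit_subset (M := M) (X := I ∪ J)
      ⟨hcon, union_subset hI.subset_ground hJ.subset_ground⟩
    obtain ⟨p, hp, hpJ⟩ : ∃ p ∈ C, p ∉ J := by
      by_contra! h; exact hC.not_indep (hJ.subset h)
    obtain ⟨q, hq, hqI⟩ : ∃ q ∈ C, q ∉ I := by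
      by_contra! h; exact hC.not_indep (hI.subset h)
    have hpS := hIS ((hCs hp).resolve_right hpJ)
    have hqS : q ∉ S := fun h => hd.le_bot ⟨(hCs hq).resolve_left hqI, h⟩
    refine hqS ⟨hC.subset_ground hq, Or.inr ?_⟩
    rcases hpS.2 with rfl | ⟨C', h1, h2, h3⟩
    · exact ⟨C, hC, hp, hq⟩
    · exact exists_isCircuit_of_inter_nonempty _ C' C h1 hC h2 hq ⟨p, h3, hp⟩ rfl

lemma Splits.not_isConnected [M.Finite] (h : Splits M M.E S) {e f : α} (he : e ∈ M.E)
    (hf : f ∈ M.E) (heS : e ∈ S) (hfS : f ∉ S) : ¬ IsConnected M := by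
  intro hcon
  obtain ⟨C, hC, heC, hfC⟩ := hcon e he f hf (fun h => hfS (h ▸ heS))
  have h1 : M.Indep (C ∩ S) := hC.ssubset_indep
    (inter_subset_left.ssubset_of_ne fun h => hfS (inter_eq_left.1 h hfC))
  have h2 : M.Indep (C \ S) := hC.ssubset_indep
    (sdiff_subset.ssubset_of_ne fun h => (h.symm ▸ heC : e ∈ C \ S).2 heS)
  have := h h1 h2 inter_subset_right (sdiff_subset.trans hC.subset_ground) disjoint_sdiff_left
  rw [inter_union_sdiff] at this
  exact hC.not_indep this

end SplitMatroid

namespace SplitPolytope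

section General

variable {V : Type*} [AddCommGroup V] [Module ℝ V]

/-! ### Faces of convex hulls of finite sets -/

lemma le_of_mem_convexHull {X : Set V} {l : V →ₗ[ℝ] ℝ} {c : ℝ} (h : ∀ y ∈ X, l y ≤ c) {x : V}
    (hx : x ∈ convexHull ℝ X) : l x ≤ c :=
  convexHull_min (t := {y | l y ≤ c}) h (convex_halfSpace_le l.isLinear c) hx

lemma ge_of_mem_convexHull {X : Set V} {l : V →ₗ[ℝ] ℝ} {c : ℝ} (h : ∀ y ∈ X, c ≤ l y) {x : V}
    (hx : x ∈ convexHull ℝ X) : c ≤ l x :=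
  convexHull_min (t := {y | c ≤ l y}) h (convex_halfSpace_ge l.isLinear c) hx

/-- In a convex combination attaining the bound, the nonnegative terms `w y * (c - l y)` sum to
zero, so only points with `l y = c` carry weight. -/
lemma mem_convexHull_of_eq_max {X : Set V} (hX : X.Finite) {l : V →ₗ[ℝ] ℝ} {c : ℝ}
    (h : ∀ y ∈ X, l y ≤ c) {x : V} (hx : x ∈ convexHull ℝ X) (hc : l x = c) :
    x ∈ convexHull ℝ {y ∈ X | l y = c} := by
  classical
  lift X to Finset V using hX
  obtain ⟨w, h0, h1, rfl⟩ := Finset.mem_convexHull'.1 hx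
  have hz : ∀ y ∈ X, w y * (c - l y) = 0 := by
    refine (Finset.sum_eq_zero_iff_of_nonneg fun y hy =>
      mul_nonneg (h0 y hy) (sub_nonneg.2 (h y hy))).1 ?_
    simp only [mul_sub, Finset.sum_sub_distrib, ← Finset.sum_mul, h1]
    rw [map_sum] at hc
    simp only [map_smul, smul_eq_mul] at hc
    linarith
  have hw : ∀ y ∈ X, ¬ l y = c → w y = 0 := fun y hy hne =>
    (mul_eq_zero.1 (hz y hy)).resolve_right fun h => hne (by linarith)
  have e : {y | y ∈ (X : Set V) ∧ l y = c} = ((X.filter fun y => l y = c : Finset V) : Set V) := by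
    ext; simp
  rw [e, Finset.mem_convexHull']
  refine ⟨w, fun y hy => h0 y (Finset.mem_filter.1 hy).1, ?_, ?_⟩
  · rw [← h1]
    exact Finset.sum_filter_of_ne fun y hy hne => by_contra fun h => hne (hw y hy h)
  · exact Finset.sum_filter_of_ne fun y hy hne => by_contra fun h => hne (by rw [hw y hy h, zero_smul])

lemma IsPolytope.convex {P : Set V} (hP : IsPolytope P) : Convex ℝ P := by
  obtain ⟨X, -, rfl⟩ := hP; exact convex_convexHull ℝ X

variable [TopologicalSpace V]

lemma isFace_setOf_eq {P : Set V} {l : StrongDual ℝ V} {c : ℝ} (h : ∀ y ∈ P, l y ≤ c) :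
    IsFace P {x | x ∈ P ∧ l x = c} := by
  rintro ⟨x₀, h₀, rfl⟩
  refine ⟨l, ?_⟩
  ext x
  exact ⟨fun hx => ⟨hx.1, fun y hy => hx.2 ▸ h y hy⟩,
    fun hx => ⟨hx.1, le_antisymm (h x hx.1) (hx.2 x₀ h₀)⟩⟩

lemma IsPolytope.face {P G : Set V} (hP : IsPolytope P) (hG : IsFace P G) : IsPolytope G := by
  rcases G.eq_empty_or_nonempty with rfl | hne
  · exact ⟨∅, finite_empty, by simp⟩
  have hconv : Convex ℝ G := IsExposed.convex hG hP.convex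
  obtain ⟨X, hX, rfl⟩ := hP
  obtain ⟨l, hl⟩ := hG hne
  obtain ⟨x₀, h₀⟩ := hne
  have h₀' := h₀
  rw [hl] at h₀'
  refine ⟨{y ∈ X | l y = l x₀}, hX.subset (sep_subset _ _), subset_antisymm (fun x hx => ?_) ?_⟩
  · rw [hl] at hx
    exact mem_convexHull_of_eq_max (l := l.toLinearMap) hX
      (fun y hy => h₀'.2 y (subset_convexHull ℝ X hy)) hx.1
      (le_antisymm (h₀'.2 x hx.1) (hx.2 x₀ h₀'.1))
  · refine convexHull_min (fun y hy => ?_) hconv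
    rw [hl]
    exact ⟨subset_convexHull ℝ X hy.1, fun z hz => hy.2 ▸ h₀'.2 z hz⟩

/-- If `l₁` exposes `G` and `l₂` exposes `K` in `G`, then `N • l₁ + l₂` exposes `K` in `P` for large
`N`. Finitely many generating points make one `N` suffice. -/
lemma IsFace.trans_of_isPolytope {P G K : Set V} (hP : IsPolytope P) (hG : IsFace P G)
    (hK : IsFace G K) : IsFace P K := by
  intro hne
  have hKconv : Convex ℝ K := IsExposed.convex hK (IsExposed.convex hG hP.convex)
  obtain ⟨X, hX, rfl⟩ := hP
  obtain ⟨x₀, h₀⟩ := hne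
  obtain ⟨l₁, h₁⟩ := hG ⟨x₀, IsExposed.subset hK h₀⟩
  obtain ⟨l₂, h₂⟩ := hK ⟨x₀, h₀⟩
  have hK₀ := h₀
  rw [h₂] at hK₀
  have hG₀ := hK₀.1
  rw [h₁] at hG₀
  -- Where `l₁ y = l₁ x₀` the quotient is `0` by convention; those points lie in `G` and are handled
  -- without the bound.
  obtain ⟨N₀, hN₀⟩ := (hX.image fun y => (l₂ y - l₂ x₀) / (l₁ x₀ - l₁ y)).bddAbove
  set N := N₀ + 1
  have hGmem : ∀ y ∈ X, l₁ y = l₁ x₀ → y ∈ G := fun y hy he => by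
    rw [h₁]; exact ⟨subset_convexHull ℝ X hy, fun z hz => he ▸ hG₀.2 z hz⟩
  have hlt : ∀ y ∈ X, l₁ y ≠ l₁ x₀ → N * l₁ y + l₂ y < N * l₁ x₀ + l₂ x₀ := fun y hy hne => by
    have hpos : 0 < l₁ x₀ - l₁ y :=
      sub_pos.2 (lt_of_le_of_ne (hG₀.2 y (subset_convexHull ℝ X hy)) hne)
    have h := hN₀ (mem_image_of_mem _ hy)
    have h' : (l₂ y - l₂ x₀) / (l₁ x₀ - l₁ y) < N := lt_of_le_of_lt h (lt_add_one _)
    rw [div_lt_iff₀ hpos] at h'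
    linarith
  have hle : ∀ y ∈ X, (N • l₁ + l₂) y ≤ N * l₁ x₀ + l₂ x₀ := fun y hy => by
    simp only [add_apply, smul_apply, smul_eq_mul]
    by_cases he : l₁ y = l₁ x₀
    · rw [he]; linarith [hK₀.2 y (hGmem y hy he)]
    · exact (hlt y hy he).le
  have hle' : ∀ x ∈ convexHull ℝ X, (N • l₁ + l₂) x ≤ N * l₁ x₀ + l₂ x₀ := fun x hx =>
    le_of_mem_convexHull (l := (N • l₁ + l₂ : StrongDual ℝ V).toLinearMap) hle hx
  have hKeq : ∀ x ∈ K, l₁ x = l₁ x₀ ∧ l₂ x = l₂ x₀ := fun x hx => by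
    rw [h₂] at hx
    have hx' := hx.1
    rw [h₁] at hx'
    exact ⟨le_antisymm (hG₀.2 x hx'.1) (hx'.2 x₀ hG₀.1),
      le_antisymm (hK₀.2 x hx.1) (hx.2 x₀ hK₀.1)⟩
  refine ⟨N • l₁ + l₂, Subset.antisymm ?_ ?_⟩
  · refine fun x hx => ⟨IsExposed.subset hG (IsExposed.subset hK hx), fun y hy => ?_⟩
    have := hle' y hy
    simpa [(hKeq x hx).1, (hKeq x hx).2] using this
  · intro x hx
    have hx0 : (N • l₁ + l₂) x = N * l₁ x₀ + l₂ x₀ :=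
      le_antisymm (hle' x hx.1) (by simpa using hx.2 x₀ hG₀.1)
    have hmem := mem_convexHull_of_eq_max (l := (N • l₁ + l₂ : StrongDual ℝ V).toLinearMap) hX hle
      hx.1 hx0
    refine convexHull_min ?_ hKconv hmem
    rintro y ⟨hy, hye⟩
    have hye' : N * l₁ y + l₂ y = N * l₁ x₀ + l₂ x₀ := by simpa using hye
    have he : l₁ y = l₁ x₀ := by
      by_contra hne
      exact (hlt y hy hne).ne hye'
    have he₂ : l₂ y = l₂ x₀ := by rw [he] at hye'; linarith
    rw [h₂]
    exact ⟨hGmem y hy he, fun z hz => he₂ ▸ hK₀.2 z hz⟩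

/-! ### Splits along a hyperplane -/

/-- A hyperplane that meets no edge of a polytope in an interior point and has vertices on both
sides is a split hyperplane. -/
lemma isSplitHyperplane_of_subset_union {X : Set V} (hX : X.Finite) (l : StrongDual ℝ V) (c : ℝ)
    (hext : X ⊆ (convexHull ℝ X).extremePoints ℝ)
    (hsub : convexHull ℝ X ⊆ convexHull ℝ {y ∈ X | l y ≤ c} ∪ convexHull ℝ {y ∈ X | c ≤ l y})
    (hlt : ∃ y ∈ X, l y < c) (hgt : ∃ y ∈ X, c < l y) :
    IsSplitHyperplane (convexHull ℝ X) (affineSpan ℝ ({x | l x = c} ∩ convexHull ℝ X)) := by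
  set X₁ := {y ∈ X | l y ≤ c} with hX₁
  set X₂ := {y ∈ X | c ≤ l y} with hX₂
  have hf₁ : X₁.Finite := hX.subset (sep_subset _ _)
  have hf₂ : X₂.Finite := hX.subset (sep_subset _ _)
  set Q₁ := convexHull ℝ X₁ with hQ₁
  set Q₂ := convexHull ℝ X₂ with hQ₂
  have hp₁ : IsPolytope Q₁ := ⟨X₁, hf₁, rfl⟩
  have hp₂ : IsPolytope Q₂ := ⟨X₂, hf₂, rfl⟩
  have hle : ∀ x ∈ Q₁, l x ≤ c := fun x hx =>
    le_of_mem_convexHull (l := l.toLinearMap) (fun y hy => hy.2) hx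
  have hge : ∀ x ∈ Q₂, c ≤ l x := fun x hx =>
    ge_of_mem_convexHull (l := l.toLinearMap) (fun y hy => hy.2) hx
  have hs₁ : Q₁ ⊆ convexHull ℝ X := convexHull_mono (sep_subset _ _)
  have hs₂ : Q₂ ⊆ convexHull ℝ X := convexHull_mono (sep_subset _ _)
  have hc₁ : {y ∈ X₁ | l y = c} ⊆ X₂ := fun y hy => ⟨hy.1.1, hy.2.ge⟩
  have hc₂ : {y ∈ X₂ | -l y = -c} ⊆ X₁ := fun y hy => ⟨hy.1.1, (neg_injective hy.2).le⟩
  have h12 : ∀ x ∈ Q₁, l x = c → x ∈ Q₂ := fun x hx he => convexHull_mono hc₁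
    (mem_convexHull_of_eq_max (l := l.toLinearMap) hf₁ (fun y hy => hy.2) hx he)
  have h21 : ∀ x ∈ Q₂, l x = c → x ∈ Q₁ := fun x hx he => convexHull_mono hc₂
    (mem_convexHull_of_eq_max (l := -l.toLinearMap) (c := -c) hf₂
      (fun y hy => neg_le_neg hy.2) hx (congrArg Neg.neg he))
  have hR₁ : IsFace Q₁ (Q₁ ∩ Q₂) := by
    have : Q₁ ∩ Q₂ = {x | x ∈ Q₁ ∧ l x = c} := subset_antisymm
      (fun x hx => ⟨hx.1, le_antisymm (hle x hx.1) (hge x hx.2)⟩)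
      fun x hx => ⟨hx.1, h12 x hx.1 hx.2⟩
    rw [this]
    exact isFace_setOf_eq hle
  have hR₂ : IsFace Q₂ (Q₁ ∩ Q₂) := by
    have : Q₁ ∩ Q₂ = {x | x ∈ Q₂ ∧ (-l) x = -c} := subset_antisymm
      (fun x hx => ⟨hx.2, congrArg Neg.neg (le_antisymm (hle x hx.1) (hge x hx.2))⟩)
      fun x hx => ⟨h21 x hx.1 (neg_injective hx.2), hx.1⟩
    rw [this]
    exact isFace_setOf_eq fun y hy => neg_le_neg (hge y hy)
  have hn12 : ¬ Q₁ ⊆ Q₂ := fun h => by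
    obtain ⟨y, hy, hyc⟩ := hlt
    exact hyc.not_ge (hge y (h (subset_convexHull ℝ _ ⟨hy, hyc.le⟩)))
  have hn21 : ¬ Q₂ ⊆ Q₁ := fun h => by
    obtain ⟨y, hy, hyc⟩ := hgt
    exact hyc.not_ge (hle y (h (subset_convexHull ℝ _ ⟨hy, hyc.le⟩)))
  -- The cells are all faces of the two halves. A face of `Q₁` meets a face of `Q₂` inside `Q₁ ∩
  -- Q₂`, a common face of both, so transitivity of faces gives the intersection axiom.
  set C : Set (Set V) := {G | IsFace Q₁ G ∨ IsFace Q₂ G} with hC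
  have hmem₁ : Q₁ ∈ C := Or.inl (IsExposed.refl (𝕜 := ℝ) _)
  have hmem₂ : Q₂ ∈ C := Or.inr (IsExposed.refl (𝕜 := ℝ) _)
  have hmax₁ : Maximal (fun K => K ∈ C) Q₁ := by
    refine ⟨hmem₁, ?_⟩
    rintro K (hK | hK) hQK
    · exact IsExposed.subset hK
    · exact absurd (hQK.trans (IsExposed.subset hK)) hn12
  have hmax₂ : Maximal (fun K => K ∈ C) Q₂ := by
    refine ⟨hmem₂, ?_⟩
    rintro K (hK | hK) hQK
    · exact absurd (hQK.trans (IsExposed.subset hK)) hn21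
    · exact IsExposed.subset hK
  have hne : Q₁ ≠ Q₂ := fun h => hn12 h.subset
  -- faces of `Q₁` and `Q₂` meet in common faces
  have hmixed : ∀ G₁ G₂, IsFace Q₁ G₁ → IsFace Q₂ G₂ →
      IsFace G₁ (G₁ ∩ G₂) ∧ IsFace G₂ (G₁ ∩ G₂) := by
    intro G₁ G₂ h₁ h₂
    have hG₁ := IsExposed.subset h₁
    have hG₂ := IsExposed.subset h₂
    have e₁ : IsFace Q₁ (G₂ ∩ (Q₁ ∩ Q₂)) := IsFace.trans_of_isPolytope hp₁ hR₁
      (IsExposed.mono (IsExposed.inter h₂ hR₂) inter_subset_right inter_subset_right)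
    have e₂ : IsFace Q₂ (G₁ ∩ (Q₁ ∩ Q₂)) := IsFace.trans_of_isPolytope hp₂ hR₂
      (IsExposed.mono (IsExposed.inter h₁ hR₁) inter_subset_left inter_subset_right)
    have f₁ : G₁ ∩ (G₂ ∩ (Q₁ ∩ Q₂)) = G₁ ∩ G₂ := by
      ext x; exact ⟨fun h => ⟨h.1, h.2.1⟩, fun h => ⟨h.1, h.2, hG₁ h.1, hG₂ h.2⟩⟩
    have f₂ : G₂ ∩ (G₁ ∩ (Q₁ ∩ Q₂)) = G₁ ∩ G₂ := by
      ext x; exact ⟨fun h => ⟨h.2.1, h.1⟩, fun h => ⟨h.2, h.1, hG₁ h.1, hG₂ h.2⟩⟩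
    exact ⟨IsExposed.mono (f₁ ▸ IsExposed.inter h₁ e₁) hG₁ inter_subset_left,
      IsExposed.mono (f₂ ▸ IsExposed.inter h₂ e₂) hG₂ inter_subset_right⟩
  have hpure : ∀ Q G₁ G₂ : Set V, IsFace Q G₁ → IsFace Q G₂ →
      IsFace G₁ (G₁ ∩ G₂) ∧ IsFace G₂ (G₁ ∩ G₂) := fun Q G₁ G₂ h₁ h₂ =>
    ⟨IsExposed.mono (IsExposed.inter h₁ h₂) (IsExposed.subset h₁) inter_subset_left,
      IsExposed.mono (IsExposed.inter h₁ h₂) (IsExposed.subset h₂) inter_subset_right⟩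
  have hext' : ∀ Y ⊆ X, (convexHull ℝ Y).extremePoints ℝ ⊆ (convexHull ℝ X).extremePoints ℝ :=
    fun Y hY => extremePoints_convexHull_subset.trans (hY.trans hext)
  refine ⟨C, ⟨?_, ?_, ?_, ?_, ?_, ?_, ?_⟩, Q₁, Q₂, hne, hmax₁, hmax₂, ?_⟩
  · rintro Q (hQ | hQ)
    · exact hp₁.face hQ
    · exact hp₂.face hQ
  · exact Or.inl isExposed_empty
  · rintro Q (hQ | hQ)
    · exact (IsExposed.isExtreme hQ).extremePoints_subset_extremePoints.trans
        (hext' _ (sep_subset _ _))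
    · exact (IsExposed.isExtreme hQ).extremePoints_subset_extremePoints.trans
        (hext' _ (sep_subset _ _))
  · rintro Q (hQ | hQ) G hG
    · exact Or.inl (hQ.trans_of_isPolytope hp₁ hG)
    · exact Or.inr (hQ.trans_of_isPolytope hp₂ hG)
  · rintro G₁ (h₁ | h₁) G₂ (h₂ | h₂) -
    · exact hpure _ _ _ h₁ h₂
    · exact hmixed _ _ h₁ h₂
    · rw [inter_comm]; exact (hmixed _ _ h₂ h₁).symm
    · exact hpure _ _ _ h₁ h₂
  · refine subset_antisymm (sUnion_subset ?_) fun x hx => ?_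
    · rintro Q (hQ | hQ)
      · exact (IsExposed.subset hQ).trans hs₁
      · exact (IsExposed.subset hQ).trans hs₂
    · rcases hsub hx with h | h
      · exact ⟨Q₁, hmem₁, h⟩
      · exact ⟨Q₂, hmem₂, h⟩
  · have : {Q | Maximal (fun K => K ∈ C) Q} = {Q₁, Q₂} := by
      refine subset_antisymm (fun Q hQ => ?_) (insert_subset hmax₁ (singleton_subset_iff.2 hmax₂))
      rcases hQ.prop with h | h
      · exact Or.inl (hQ.eq_of_le hmem₁ (IsExposed.subset h))
      · exact Or.inr (hQ.eq_of_le hmem₂ (IsExposed.subset h))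
    rw [this, encard_pair hne]
  · congr 1
    refine subset_antisymm (fun x hx => ?_) fun x hx => ?_
    · rcases hsub hx.2 with h | h
      · exact ⟨h, h12 x h hx.1⟩
      · exact ⟨h21 x h hx.1, h⟩
    · exact ⟨le_antisymm (hle x hx.1) (hge x hx.2), hs₁ hx.1⟩

end General

/-! ### The hypersimplex -/

section Hypersimplex

variable {ι : Type*}

lemma indicator_mem_extremePoints {P : Set (ι → ℝ)} (hP : P ⊆ Icc 0 1) (S : Set ι)
    (hS : S.indicator 1 ∈ P) : S.indicator 1 ∈ P.extremePoints ℝ := by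
  rw [mem_extremePoints_iff_left]
  refine ⟨hS, fun x hx y hy h => ?_⟩
  obtain ⟨a, b, ha, hb, hab, he⟩ := h
  funext i
  have hxi := (hP hx).1 i
  have hxi' := (hP hx).2 i
  have hyi := (hP hy).1 i
  have hyi' := (hP hy).2 i
  have hi := congrFun he i
  simp only [Pi.add_apply, Pi.smul_apply, smul_eq_mul, Pi.zero_apply, Pi.one_apply] at *
  by_cases his : i ∈ S
  · rw [indicator_of_mem his] at hi ⊢
    simp only [Pi.one_apply] at *
    nlinarith
  · rw [indicator_of_notMem his] at hi ⊢
    nlinarith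

lemma indicator_mem_Icc (S : Set ι) : (S.indicator 1 : ι → ℝ) ∈ Icc 0 1 :=
  ⟨fun _ => indicator_apply_nonneg fun _ => zero_le_one,
    fun _ => indicator_apply_le' (fun _ => le_rfl) fun _ => zero_le_one⟩

variable [Finite ι]

/-- The sum of the coordinates indexed by `A`. -/
noncomputable def coordSum (A : Set ι) : StrongDual ℝ (ι → ℝ) :=
  LinearMap.toContinuousLinearMap
    { toFun := fun x => ∑ᶠ i ∈ A, x i
      map_add' := fun x y => finsum_mem_add_distrib A.toFinite
      map_smul' := fun c x => by
        simp only [Pi.smul_apply, smul_eq_mul, RingHom.id_apply]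
        exact (mul_finsum_mem' x c A.toFinite).symm }

lemma coordSum_apply (A : Set ι) (x : ι → ℝ) : coordSum A x = ∑ᶠ i ∈ A, x i := rfl

lemma coordSum_indicator (A B : Set ι) : coordSum A (B.indicator 1) = ((B ∩ A).ncard : ℝ) := by
  rw [coordSum_apply, inter_comm, finsum_mem_def]
  have : (fun a => A.indicator (fun i => B.indicator (1 : ι → ℝ) i) a)
      = (A ∩ B).indicator (1 : ι → ℝ) := by
    rw [← indicator_indicator]
  rw [this, ← finsum_mem_def, finsum_mem_eq_finite_toFinset_sum _ (A ∩ B).toFinite,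
    ncard_eq_toFinset_card _ (A ∩ B).toFinite]
  simp

lemma hypersimplex_eq (r : ℕ) (ι : Type*) [Finite ι] :
    hypersimplex r ι = convexHull ℝ {x | ∃ S : Set ι, S.ncard = r ∧ x = S.indicator 1} := by
  unfold hypersimplex
  congr 1
  ext x
  constructor
  · rintro ⟨S, hS, rfl⟩
    exact ⟨S, by rw [ncard_coe_finset, hS], rfl⟩
  · rintro ⟨S, hS, rfl⟩
    exact ⟨S.toFinite.toFinset, by rw [← hS, ncard_eq_toFinset_card], by simp⟩

lemma finite_setOf_indicator (r : ℕ) :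
    {x : ι → ℝ | ∃ S : Set ι, S.ncard = r ∧ x = S.indicator 1}.Finite :=
  (finite_range fun S : Set ι => (S.indicator 1 : ι → ℝ)).subset
    fun _ ⟨S, _, hS⟩ => ⟨S, hS.symm⟩

/-- Two sets of the same size, one of which meets `A` in more elements, can be moved closer to each
other by exchanging an element of `A` and an element outside `A`. -/
lemma exists_exchange {S T A : Set ι} (hc : S.ncard = T.ncard)
    (h : (T ∩ A).ncard < (S ∩ A).ncard) :
    ∃ S' T' : Set ι, S'.ncard = S.ncard ∧ T'.ncard = T.ncard ∧
      (S' ∩ A).ncard + 1 = (S ∩ A).ncard ∧ (T' ∩ A).ncard = (T ∩ A).ncard + 1 ∧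
      (S'.indicator 1 + T'.indicator 1 : ι → ℝ) = S.indicator 1 + T.indicator 1 := by
  obtain ⟨e, he, he'⟩ := exists_mem_notMem_of_ncard_lt_ncard h
  have e1 := ncard_inter_add_ncard_sdiff_eq_ncard S A
  have e2 := ncard_inter_add_ncard_sdiff_eq_ncard T A
  obtain ⟨f, hf, hf'⟩ := exists_mem_notMem_of_ncard_lt_ncard
    (show (S \ A).ncard < (T \ A).ncard by omega)
  have heT : e ∉ T := fun h => he' ⟨h, he.2⟩
  have hfS : f ∉ S := fun h => hf' ⟨h, hf.2⟩
  have hef : e ≠ f := fun h => hfS (h ▸ he.1)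
  refine ⟨insert f (S \ {e}), insert e (T \ {f}), ?_, ?_, ?_, ?_, ?_⟩
  · rw [ncard_insert_of_notMem (fun h => hfS h.1), ncard_sdiff_singleton_add_one he.1]
  · rw [ncard_insert_of_notMem (fun h => heT h.1), ncard_sdiff_singleton_add_one hf.1]
  · rw [insert_inter_of_notMem hf.2, ← inter_sdiff_right_comm,
      ncard_sdiff_singleton_add_one he]
  · have : T \ {f} ∩ A = T ∩ A := by
      rw [← inter_sdiff_right_comm, sdiff_singleton_eq_self fun h => hf.2 h.2]
    rw [insert_inter_of_mem he.2, this, ncard_insert_of_notMem he']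
  · funext i
    by_cases hie : i = e
    · subst hie; simp [he.1, heT, hef]
    by_cases hif : i = f
    · subst hif; simp [hf.1, hfS, hef.symm]
    by_cases hiS : i ∈ S <;> by_cases hiT : i ∈ T <;> simp [hie, hif, hiS, hiT]

/-- The vertices representing `x` can be taken on one side of the hyperplane. Among all
representations, take one minimising `∑ w S * (|S ∩ A| - k) ^ 2`, which exists by compactness. If
`S` and `T` with positive weight lie strictly on opposite sides, moving weight `δ` to their
exchanged pair keeps `x` and lowers this sum. -/
lemma exists_weights {r : ℕ} {x : ι → ℝ} [Fintype (Set ι)] (hx : x ∈ hypersimplex r ι) (A : Set ι)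
    (k : ℕ) :
    ∃ w : Set ι → ℝ, (∀ S, 0 ≤ w S) ∧ ∑ S, w S = 1 ∧
      ∑ S, w S • (S.indicator 1 : ι → ℝ) = x ∧ (∀ S, S.ncard ≠ r → w S = 0) ∧
      ((∀ S, w S ≠ 0 → (S ∩ A).ncard ≤ k) ∨ ∀ S, w S ≠ 0 → k ≤ (S ∩ A).ncard) := by
  classical
  set D : Set (Set ι → ℝ) := {w | (∀ S, 0 ≤ w S) ∧ ∑ S, w S = 1 ∧ ∀ S, S.ncard ≠ r → w S = 0}
    with hD
  set L : (Set ι → ℝ) →ₗ[ℝ] (ι → ℝ) :=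
    ∑ S, (LinearMap.proj S : (Set ι → ℝ) →ₗ[ℝ] ℝ).smulRight (S.indicator 1) with hL
  have hLa : ∀ w, L w = ∑ S, w S • (S.indicator 1 : ι → ℝ) := fun w => by simp [hL]
  have hDc : Convex ℝ D := by
    intro w hw w' hw' a b ha hb hab
    refine ⟨fun S => ?_, ?_, fun S hS => ?_⟩
    · exact add_nonneg (mul_nonneg ha (hw.1 S)) (mul_nonneg hb (hw'.1 S))
    · simp [Finset.sum_add_distrib, ← Finset.mul_sum, hw.2.1, hw'.2.1, hab]
    · simp [hw.2.2 S hS, hw'.2.2 S hS]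
  obtain ⟨w₀, hw₀, hw₀x⟩ : x ∈ L '' D := by
    rw [hypersimplex_eq] at hx
    refine convexHull_min ?_ (hDc.linear_image L) hx
    rintro _ ⟨S, hS, rfl⟩
    refine ⟨Pi.single S 1, ⟨fun T => ?_, by simp, fun T hT => ?_⟩, ?_⟩
    · by_cases h : T = S
      · subst h; simp
      · simp [h]
    · rw [Pi.single_eq_of_ne]; rintro rfl; exact hT hS
    · rw [hLa, Finset.sum_eq_single S] <;> simp +contextual
  set W : Set (Set ι → ℝ) := D ∩ L ⁻¹' {x} with hW
  have hDcl : IsClosed D := by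
    simp only [hD, Set.ofPred_and, Set.ofPred_forall]
    refine (isClosed_iInter fun S => isClosed_le continuous_const (continuous_apply S)).inter
      ((isClosed_eq (by fun_prop) continuous_const).inter
        (isClosed_iInter fun S => isClosed_iInter fun _ =>
          isClosed_eq (continuous_apply S) continuous_const))
  have hLc : Continuous L := L.continuous_of_finiteDimensional
  have hWc : IsCompact W := by
    refine (isCompact_Icc (a := (0 : Set ι → ℝ)) (b := 1)).of_isClosed_subset
      (hDcl.inter (isClosed_singleton.preimage hLc)) fun w hw => ⟨hw.1.1, fun S => ?_⟩
    rw [Pi.one_apply, ← hw.1.2.1]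
    exact Finset.single_le_sum (fun T _ => hw.1.1 T) (Finset.mem_univ S)
  set g : Set ι → ℝ := fun S => (S ∩ A).ncard with hg
  set Φ : (Set ι → ℝ) → ℝ := fun w => ∑ S, w S * (g S - k) ^ 2 with hΦ
  obtain ⟨w, hwW, hmin⟩ := hWc.exists_isMinOn ⟨w₀, hw₀, hw₀x⟩
    (f := Φ) (by fun_prop : Continuous Φ).continuousOn
  refine ⟨w, hwW.1.1, hwW.1.2.1, (hLa w).symm.trans hwW.2, hwW.1.2.2, ?_⟩
  by_contra hcon
  push Not at hcon
  obtain ⟨⟨S, hS, hSk⟩, ⟨T, hT, hTk⟩⟩ := hcon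
  have hSr : S.ncard = r := by_contra fun h => hS (hwW.1.2.2 S h)
  have hTr : T.ncard = r := by_contra fun h => hT (hwW.1.2.2 T h)
  have hST : S ≠ T := by rintro rfl; omega
  obtain ⟨S', T', hS', hT', hSA, hTA, hadd⟩ := exists_exchange (hSr.trans hTr.symm)
    (hTk.trans hSk)
  set δ := min (w S) (w T) with hδ
  have hδ0 : 0 < δ := lt_min (lt_of_le_of_ne (hwW.1.1 S) hS.symm)
    (lt_of_le_of_ne (hwW.1.1 T) hT.symm)
  set u : Set ι → ℝ := Pi.single S' δ + Pi.single T' δ - Pi.single S δ - Pi.single T δ with hu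
  have hsum : ∀ f : Set ι → ℝ, ∑ U, u U * f U = δ * (f S' + f T' - f S - f T) := by
    intro f
    simp only [hu, Pi.add_apply, Pi.sub_apply, add_mul, sub_mul, Finset.sum_add_distrib,
      Finset.sum_sub_distrib, Pi.single_apply, ite_mul, zero_mul, Finset.sum_ite_eq',
      Finset.mem_univ, if_true]
    ring
  have hsingle : ∀ U U' : Set ι, (0 : ℝ) ≤ (Pi.single U δ : Set ι → ℝ) U' := fun U U' => by
    rw [Pi.single_apply]; split_ifs <;> linarith
  have hw' : w + u ∈ W := by
    refine ⟨⟨fun U => ?_, ?_, fun U hU => ?_⟩, ?_⟩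
    · have h1 := hsingle S' U
      have h2 := hsingle T' U
      have h3 : (Pi.single S δ : Set ι → ℝ) U + (Pi.single T δ : Set ι → ℝ) U ≤ w U := by
        by_cases hUS : U = S
        · subst hUS; simp [hST, hδ]
        by_cases hUT : U = T
        · subst hUT; simp [hST.symm, hδ]
        simp [hUS, hUT, hwW.1.1 U]
      simp only [hu, Pi.add_apply, Pi.sub_apply]
      linarith
    · have := hsum 1
      simp only [Pi.one_apply, mul_one] at this
      simp [Finset.sum_add_distrib, this, hwW.1.2.1]
    · have h1 : U ≠ S' := by rintro rfl; omega
      have h2 : U ≠ T' := by rintro rfl; omega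
      have h3 : U ≠ S := by rintro rfl; omega
      have h4 : U ≠ T := by rintro rfl; omega
      simp [hu, h1, h2, h3, h4, hwW.1.2.2 U hU]
    · have hLu : L u = 0 := by
        funext i
        have hi := congrFun hadd i
        simp only [Pi.add_apply] at hi
        have := hsum fun U => (U.indicator 1 : ι → ℝ) i
        rw [hLa]
        simp only [Finset.sum_apply, Pi.smul_apply, smul_eq_mul, this, Pi.zero_apply]
        rw [hi]; ring
      change L (w + u) = x
      rw [map_add, hLu, add_zero]
      exact hwW.2
  have hlt : Φ (w + u) < Φ w := by
    have h1 : Φ (w + u) = Φ w + ∑ U, u U * (g U - k) ^ 2 := by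
      simp [hΦ, add_mul, Finset.sum_add_distrib]
    have e1 : g S = g S' + 1 := by simp only [hg]; exact_mod_cast hSA.symm
    have e2 : g T' = g T + 1 := by simp only [hg]; exact_mod_cast hTA
    have e3 : (k : ℝ) + 1 ≤ g S := by simp only [hg]; exact_mod_cast hSk
    have e4 : g T + 1 ≤ (k : ℝ) := by simp only [hg]; exact_mod_cast hTk
    rw [h1, hsum]
    have : (g S' - k) ^ 2 + (g T' - k) ^ 2 - (g S - k) ^ 2 - (g T - k) ^ 2 < 0 := by
      rw [e2, e1]; rw [e1] at e3; nlinarith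
    nlinarith
  exact absurd (hmin hw') (not_le.2 hlt)

/-- The four strict inequalities provide vertices with `k - 1` and with `k + 1` ones in `A`, one on
each side. -/
lemma isSplitHyperplane_hypersimplex {r k : ℕ} {A : Set ι} (hk : 0 < k) (hkA : k < A.ncard)
    (hkr : k < r) (hrA : r - k < Aᶜ.ncard) :
    IsSplitHyperplane (hypersimplex r ι)
      (affineSpan ℝ ({x | coordSum A x = k} ∩ hypersimplex r ι)) := by
  classical
  have : Fintype (Set ι) := Fintype.ofFinite _
  have hex : ∀ j, j ≤ A.ncard → j ≤ r → r - j ≤ Aᶜ.ncard →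
      ∃ S : Set ι, S.ncard = r ∧ (S ∩ A).ncard = j := by
    intro j h1 h2 h3
    obtain ⟨U, hU, hUj⟩ := exists_subset_card_eq h1
    obtain ⟨V, hV, hVj⟩ := exists_subset_card_eq h3
    have hd : Disjoint U V := disjoint_compl_right.mono hU hV
    refine ⟨U ∪ V, ?_, ?_⟩
    · rw [ncard_union_eq hd, hUj, hVj]; omega
    · rw [union_inter_distrib_right, inter_eq_self_of_subset_left hU,
        (disjoint_compl_left.mono_left hV).inter_eq, union_empty, hUj]
  have hIcc : hypersimplex r ι ⊆ Icc 0 1 := by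
    rw [hypersimplex_eq]
    refine convexHull_min ?_ (convex_Icc 0 1)
    rintro _ ⟨S, -, rfl⟩
    exact indicator_mem_Icc S
  have hsubset := subset_convexHull ℝ {x : ι → ℝ | ∃ S : Set ι, S.ncard = r ∧ x = S.indicator 1}
  have hweights := fun x hx => exists_weights (r := r) (x := x) hx A k
  rw [hypersimplex_eq] at hIcc hweights ⊢
  refine isSplitHyperplane_of_subset_union (finite_setOf_indicator r) (coordSum A) k ?_ ?_ ?_ ?_
  · intro x hx
    have hx' := hsubset hx
    obtain ⟨S, -, rfl⟩ := hx
    exact indicator_mem_extremePoints hIcc S hx'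
  · intro x hx
    obtain ⟨w, h0, h1, rfl, h3, h4⟩ := hweights x hx
    have key : ∀ Y : Set (ι → ℝ), (∀ S, w S ≠ 0 → S.indicator 1 ∈ Y) →
        ∑ S, w S • (S.indicator 1 : ι → ℝ) ∈ convexHull ℝ Y := by
      intro Y hY
      rw [← Finset.sum_filter_of_ne (p := fun S => w S ≠ 0)
        (fun S _ hne h => hne (by rw [h, zero_smul]))]
      refine (convex_convexHull ℝ Y).sum_mem (fun S _ => h0 S) ?_
        fun S hS => subset_convexHull ℝ Y (hY S (Finset.mem_filter.1 hS).2)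
      rw [← h1]
      exact Finset.sum_filter_of_ne fun S _ hne => hne
    have hr : ∀ S, w S ≠ 0 → S.ncard = r := fun S hS => by_contra fun h => hS (h3 S h)
    rcases h4 with h4 | h4
    · refine Or.inl (key _ fun S hS => ⟨⟨S, hr S hS, rfl⟩, ?_⟩)
      rw [coordSum_indicator]
      exact_mod_cast h4 S hS
    · refine Or.inr (key _ fun S hS => ⟨⟨S, hr S hS, rfl⟩, ?_⟩)
      rw [coordSum_indicator]
      exact_mod_cast h4 S hS
  · obtain ⟨S, hS, hSA⟩ := hex (k - 1) (by omega) (by omega) (by omega)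
    refine ⟨S.indicator 1, ⟨S, hS, rfl⟩, ?_⟩
    rw [coordSum_indicator, hSA]
    exact_mod_cast (by omega : k - 1 < k)
  · obtain ⟨S, hS, hSA⟩ := hex (k + 1) (by omega) (by omega) (by omega)
    refine ⟨S.indicator 1, ⟨S, hS, rfl⟩, ?_⟩
    rw [coordSum_indicator, hSA]
    exact_mod_cast (by omega : k < k + 1)

end Hypersimplex

end SplitPolytope

namespace SplitMatroid

open SplitPolytope

variable {α : Type*} {M : Matroid α} {F G S I J B : Set α}

/-! ### Faces of the matroid polytope -/

instance finite_coe_ground (M : Matroid α) [M.Finite] : Finite M.E := M.ground_finite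

/-- The characteristic vector of `B ∩ M.E`. -/
noncomputable def baseVec (M : Matroid α) (B : Set α) : M.E → ℝ := ((↑) ⁻¹' B : Set M.E).indicator 1

lemma baseVec_of_mem {e : M.E} (h : (e : α) ∈ B) : baseVec M B e = 1 := by
  rw [baseVec, indicator_of_mem (mem_preimage.2 h), Pi.one_apply]

lemma baseVec_of_notMem {e : M.E} (h : (e : α) ∉ B) : baseVec M B e = 0 := by
  rw [baseVec, indicator_of_notMem fun h' => h (mem_preimage.1 h')]

lemma basePolytope_eq (M : Matroid α) :
    basePolytope M = convexHull ℝ {x | ∃ B, M.IsBase B ∧ x = baseVec M B} := rfl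

lemma baseVec_mem (hB : M.IsBase B) : baseVec M B ∈ basePolytope M :=
  subset_convexHull ℝ _ ⟨B, hB, rfl⟩

lemma finite_setOf_baseVec (M : Matroid α) [M.Finite] :
    {x | ∃ B, M.IsBase B ∧ x = baseVec M B}.Finite :=
  (finite_range fun S : Set M.E => (S.indicator 1 : M.E → ℝ)).subset
    fun _ ⟨_, _, h⟩ => ⟨_, h.symm⟩

lemma ncard_preimage_ground {X : Set α} (hX : X ⊆ M.E) :
    ((↑) ⁻¹' X : Set M.E).ncard = X.ncard :=
  ncard_preimage_of_injective_subset_range Subtype.val_injective (by simpa using hX)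

lemma coordSum_baseVec [M.Finite] (hB : M.IsBase B) :
    coordSum ((↑) ⁻¹' F : Set M.E) (baseVec M B) = ((B ∩ F).ncard : ℝ) := by
  rw [baseVec, coordSum_indicator, ← preimage_inter,
    ncard_preimage_ground (inter_subset_left.trans hB.subset_ground)]

lemma mem_hyperplane_iff [M.Finite] {x : M.E → ℝ} :
    x ∈ hyperplane M F ↔ coordSum ((↑) ⁻¹' F : Set M.E) x = rk M F := Iff.rfl

lemma baseVec_mem_hyperplane_iff [M.Finite] (hB : M.IsBase B) :
    baseVec M B ∈ hyperplane M F ↔ Tight M F B := by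
  rw [mem_hyperplane_iff, coordSum_baseVec hB, Nat.cast_inj, Tight]

lemma convex_setOf_hyperplane [M.Finite] (F : Set α) : Convex ℝ (hyperplane M F) :=
  convex_hyperplane (f := coordSum ((↑) ⁻¹' F : Set M.E))
    (coordSum ((↑) ⁻¹' F : Set M.E)).toLinearMap.isLinear _

lemma coordSum_le_rk [M.Finite] {x : M.E → ℝ} (hx : x ∈ basePolytope M) :
    coordSum ((↑) ⁻¹' F : Set M.E) x ≤ rk M F := by
  refine le_of_mem_convexHull (l := (coordSum ((↑) ⁻¹' F : Set M.E)).toLinearMap) ?_ hx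
  rintro _ ⟨B, hB, rfl⟩
  change coordSum _ (baseVec M B) ≤ _
  rw [coordSum_baseVec hB]
  exact_mod_cast ncard_inter_le_rk hB

lemma isFace_hyperplane_inter [M.Finite] (F : Set α) :
    IsFace (basePolytope M) (hyperplane M F ∩ basePolytope M) := by
  have := isFace_setOf_eq (P := basePolytope M) (l := coordSum ((↑) ⁻¹' F : Set M.E))
    (c := rk M F) fun y hy => coordSum_le_rk hy
  rwa [show {x | x ∈ basePolytope M ∧ coordSum ((↑) ⁻¹' F : Set M.E) x = rk M F}
    = hyperplane M F ∩ basePolytope M from inter_comm _ _] at this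

lemma hyperplane_inter_subset_iff [M.Finite] :
    hyperplane M F ∩ basePolytope M ⊆ hyperplane M G ∩ basePolytope M ↔
      ∀ B, M.IsBase B → Tight M F B → Tight M G B := by
  constructor
  · intro h B hB hT
    exact (baseVec_mem_hyperplane_iff hB).1
      (h ⟨(baseVec_mem_hyperplane_iff hB).2 hT, baseVec_mem hB⟩).1
  · rintro h x ⟨hx, hxP⟩
    refine ⟨convexHull_min ?_ (convex_setOf_hyperplane G) (mem_convexHull_of_eq_max
      (l := (coordSum ((↑) ⁻¹' F : Set M.E)).toLinearMap) (c := rk M F) (finite_setOf_baseVec M)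
      (fun y hy => coordSum_le_rk (subset_convexHull ℝ _ hy)) hxP
      (mem_hyperplane_iff.1 hx)), hxP⟩
    rintro _ ⟨⟨B, hB, rfl⟩, hT⟩
    exact (baseVec_mem_hyperplane_iff hB).2 (h B hB ((baseVec_mem_hyperplane_iff hB).1 hT))

lemma hyperplane_inter_eq_iff [M.Finite] :
    hyperplane M F ∩ basePolytope M = hyperplane M G ∩ basePolytope M ↔
      ∀ B, M.IsBase B → (Tight M F B ↔ Tight M G B) := by
  rw [Subset.antisymm_iff, hyperplane_inter_subset_iff, hyperplane_inter_subset_iff]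
  exact ⟨fun h B hB => ⟨h.1 B hB, h.2 B hB⟩,
    fun h => ⟨fun B hB => (h B hB).1, fun B hB => (h B hB).2⟩⟩

lemma hyperplane_inter_eq_self_iff [M.Finite] :
    hyperplane M F ∩ basePolytope M = basePolytope M ↔ ∀ B, M.IsBase B → Tight M F B := by
  rw [inter_eq_right]
  constructor
  · exact fun h B hB => (baseVec_mem_hyperplane_iff hB).1 (h (baseVec_mem hB))
  · intro h
    refine convexHull_min ?_ (convex_setOf_hyperplane F)
    rintro _ ⟨B, hB, rfl⟩
    exact (baseVec_mem_hyperplane_iff hB).2 (h B hB)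

lemma combFacet_of_isFacet [M.Finite]
    (h : IsFacet (basePolytope M) (hyperplane M F ∩ basePolytope M)) : CombFacet M F := by
  obtain ⟨-, hne, hmax⟩ := h
  constructor
  · by_contra! hcon
    exact hne (hyperplane_inter_eq_self_iff.2 hcon)
  · intro G _ hFG
    by_cases hGF : ∀ B, M.IsBase B → Tight M G B → Tight M F B
    · exact Or.inl hGF
    · right
      rw [← hyperplane_inter_eq_self_iff]
      refine hmax _ (isFace_hyperplane_inter G) ⟨hyperplane_inter_subset_iff.2 hFG, ?_⟩
      rwa [hyperplane_inter_subset_iff]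

lemma combFlacet_of_isFlacet [M.Finite] (h : IsFlacet M F) : CombFlacet M F :=
  ⟨h.1, combFacet_of_isFacet h.2.1,
    fun F' hF' hT hs => h.2.2 F' hF' (hyperplane_inter_eq_iff.2 hT) hs⟩

/-! ### Linear functionals on bases -/

section Functional

open scoped Classical

lemma ncard_exchange_inter [M.Finite] (hB : M.IsBase B) {e f : α} (he : e ∈ B)
    (heG : e ∈ G) (hfG : f ∉ G) : (insert f (B \ {e}) ∩ G).ncard + 1 = (B ∩ G).ncard := by
  rw [insert_inter_of_notMem hfG, ← inter_sdiff_right_comm,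
    ncard_sdiff_singleton_add_one (mem_inter he heG) (hB.finite.subset inter_subset_left)]

lemma mem_iff_mem_of_tight_exchange [M.Finite] (hB : M.IsBase B) {e f : α} (he : e ∈ B)
    (hf : f ∉ B) (hB' : M.IsBase (insert f (B \ {e}))) (hT : Tight M G B)
    (hT' : Tight M G (insert f (B \ {e}))) : e ∈ G ↔ f ∈ G := by
  unfold Tight at hT hT'
  have hef : e ≠ f := fun h => hf (h ▸ he)
  constructor <;> intro h <;> by_contra h'
  · have := ncard_exchange_inter hB he h h'
    omega
  · have hB₂ : insert e (insert f (B \ {e}) \ {f}) = B := by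
      rw [insert_sdiff_self_of_notMem (fun h => hf h.1), insert_sdiff_self_of_mem he]
    have := ncard_exchange_inter hB' (e := f) (f := e) (mem_insert _ _) h h'
    rw [hB₂] at this
    omega

lemma baseVec_exchange {e f : M.E} (he : (e : α) ∈ B) (hf : (f : α) ∉ B) :
    baseVec M (insert (f : α) (B \ {(e : α)})) + Pi.single e 1 = baseVec M B + Pi.single f 1 := by
  funext i
  have hef : (e : α) ≠ f := fun h => hf (h ▸ he)
  have hef' : e ≠ f := fun h => hef (congrArg _ h)
  simp only [Pi.add_apply]
  by_cases hie : i = e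
  · subst hie
    rw [baseVec_of_notMem (by simp [hef]), baseVec_of_mem he]
    simp [hef']
  by_cases hif : i = f
  · subst hif
    rw [baseVec_of_mem (by simp), baseVec_of_notMem hf]
    simp [hef'.symm]
  rw [Pi.single_eq_of_ne hie, Pi.single_eq_of_ne hif]
  congr 1
  unfold baseVec
  have : (i : α) ≠ f ∧ (i : α) ≠ e := ⟨fun h => hif (Subtype.ext h), fun h => hie (Subtype.ext h)⟩
  by_cases hi : (i : α) ∈ B
  · rw [indicator_of_mem, indicator_of_mem] <;> simp [hi, this]
  · rw [indicator_of_notMem, indicator_of_notMem] <;> simp [hi, this]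

lemma map_baseVec_exchange (l : (M.E → ℝ) →ₗ[ℝ] ℝ) {e f : M.E}
    (he : (e : α) ∈ B) (hf : (f : α) ∉ B) :
    l (baseVec M (insert (f : α) (B \ {(e : α)}))) + l (Pi.single e 1)
      = l (baseVec M B) + l (Pi.single f 1) := by
  rw [← map_add, ← map_add, baseVec_exchange he hf]

/-- The greedy argument: if `B` does not span the superlevel set `G`, an element of `G` can be
exchanged for one of smaller weight outside `G`, which increases `l`. -/
lemma tight_of_isMax [M.Finite] (l : (M.E → ℝ) →ₗ[ℝ] ℝ) (hB : M.IsBase B)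
    (hmax : ∀ B', M.IsBase B' → l (baseVec M B') ≤ l (baseVec M B)) (t : ℝ) :
    Tight M ((↑) '' {i : M.E | t ≤ l (Pi.single i 1)}) B := by
  set G : Set α := (↑) '' {i : M.E | t ≤ l (Pi.single i 1)} with hG
  have hGE : G ⊆ M.E := by rintro _ ⟨i, -, rfl⟩; exact i.2
  refine le_antisymm (ncard_inter_le_rk hB) ?_
  by_contra! hlt
  obtain ⟨I, hI, hBI⟩ := (hB.indep.inter_right G).subset_isBasis_of_subset inter_subset_right hGE
  obtain ⟨e, heI, heB⟩ : ∃ e ∈ I, e ∉ B ∩ G := by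
    by_contra! h
    rw [← ncard_eq_rk hI] at hlt
    exact hlt.not_ge (ncard_le_ncard h (hB.finite.subset inter_subset_left))
  have heG := hI.subset heI
  have heB' : e ∉ B := fun h => heB ⟨h, heG⟩
  obtain ⟨B', hB', h1, h2⟩ := (hI.indep.subset (insert_subset heI hBI)).exists_isBase_subset_union_isBase hB
  have h2' : B' ⊆ insert e B := h2.trans (union_subset
    (insert_subset_insert inter_subset_left) (subset_insert _ _))
  have heB'' : e ∈ B' := h1 (mem_insert _ _)
  have hd : B' \ B = {e} := by
    refine Subset.antisymm (fun x hx => (h2' hx.1).resolve_right hx.2) ?_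
    exact singleton_subset_iff.2 ⟨heB'', heB'⟩
  have hc := hB'.ncard_sdiff_comm hB
  rw [hd, ncard_singleton] at hc
  obtain ⟨f, hf⟩ := ncard_eq_one.1 hc.symm
  obtain ⟨e', he', rfl⟩ := hB.eq_exchange_of_sdiff_eq_singleton hB' hf
  rw [hd, mem_singleton_iff] at he'
  subst he'
  have hfB : f ∈ B ∧ f ∉ insert e' B \ {f} := hf.symm.subset rfl
  have hef : e' ≠ f := fun h => heB' (h ▸ hfB.1)
  have hfG : f ∉ G := fun h => hfB.2 (h1 (Or.inr ⟨hfB.1, h⟩))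
  rw [← insert_sdiff_singleton_comm hef] at hB'
  have hfE := hB.subset_ground hfB.1
  obtain ⟨e, he, rfl⟩ := heG
  have hfw : l (Pi.single ⟨f, hfE⟩ 1) < t := by
    by_contra! h; exact hfG ⟨_, h, rfl⟩
  have := map_baseVec_exchange l (e := ⟨f, hfE⟩) (f := e) hfB.1 heB'
  have := hmax _ hB'
  simp only [mem_ofPred_eq] at he
  linarith

/-- Walk from `B'` to `B` by base exchanges. If both bases of an exchange are tight on every
superlevel set, the exchanged elements lie in the same superlevel sets and so have equal weight. -/
lemma map_baseVec_eq_of_forall_tight [M.Finite] (l : (M.E → ℝ) →ₗ[ℝ] ℝ)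
    (h : ∀ t : ℝ, ∀ B, M.IsBase B → Tight M ((↑) '' {i : M.E | t ≤ l (Pi.single i 1)}) B) (n : ℕ) :
    ∀ B B', M.IsBase B → M.IsBase B' → (B' \ B).ncard = n → l (baseVec M B') = l (baseVec M B) := by
  induction n with
  | zero =>
    intro B B' hB hB' hn
    rw [ncard_eq_zero (hB'.finite.sdiff), sdiff_eq_empty] at hn
    rw [hB'.eq_of_subset_isBase hB hn]
  | succ n ih =>
    intro B B' hB hB' hn
    obtain ⟨e, he⟩ := nonempty_of_ncard_ne_zero (hn.trans_ne n.succ_ne_zero)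
    obtain ⟨f, hf, hB''⟩ := hB'.exchange hB he
    have hd : (insert f (B' \ {e})) \ B = (B' \ B) \ {e} := by
      rw [insert_sdiff_of_mem _ hf.1, sdiff_right_comm]
    have hi := ih B _ hB hB'' (by rw [hd, ncard_sdiff_singleton_of_mem he, hn]; rfl)
    have heE := hB'.subset_ground he.1
    have hfE := hB.subset_ground hf.1
    have hex := map_baseVec_exchange l (B := B') (e := ⟨e, heE⟩) (f := ⟨f, hfE⟩) he.1 hf.2
    have key := fun t => mem_iff_mem_of_tight_exchange hB' he.1 hf.2 hB'' (h t _ hB') (h t _ hB'')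
    have h1 : l (Pi.single ⟨e, heE⟩ 1) ≤ l (Pi.single ⟨f, hfE⟩ 1) := by
      obtain ⟨i, hi, hie⟩ := (key (l (Pi.single ⟨e, heE⟩ 1))).1 ⟨⟨e, heE⟩, by simp, rfl⟩
      obtain rfl : i = ⟨f, hfE⟩ := Subtype.ext hie
      exact hi
    have h2 : l (Pi.single ⟨f, hfE⟩ 1) ≤ l (Pi.single ⟨e, heE⟩ 1) := by
      obtain ⟨i, hi, hie⟩ := (key (l (Pi.single ⟨f, hfE⟩ 1))).2 ⟨⟨f, hfE⟩, by simp, rfl⟩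
      obtain rfl : i = ⟨e, heE⟩ := Subtype.ext hie
      exact hi
    simp only at hex
    linarith

lemma isFacet_of_combFacet [M.Finite] (hFE : F ⊆ M.E) (h : CombFacet M F) :
    IsFacet (basePolytope M) (hyperplane M F ∩ basePolytope M) := by
  refine ⟨isFace_hyperplane_inter F, ?_, ?_⟩
  · rw [Ne, hyperplane_inter_eq_self_iff]
    obtain ⟨B, hB, hT⟩ := h.1
    exact fun h => hT (h B hB)
  · intro K hK hlt
    obtain ⟨B₀, hB₀, hT₀⟩ := exists_tight (M := M) hFE
    have hB₀K : baseVec M B₀ ∈ K :=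
      hlt.subset ⟨(baseVec_mem_hyperplane_iff hB₀).2 hT₀, baseVec_mem hB₀⟩
    have hKc : Convex ℝ K := IsExposed.convex hK (convex_convexHull ℝ _)
    obtain ⟨l, hl⟩ := hK ⟨_, hB₀K⟩
    have hmaxK : ∀ B, M.IsBase B → baseVec M B ∈ K → ∀ B', M.IsBase B' →
        l.toLinearMap (baseVec M B') ≤ l.toLinearMap (baseVec M B) := by
      intro B hB hBK B' hB'
      rw [hl] at hBK
      exact hBK.2 _ (baseVec_mem hB')
    set G : ℝ → Set α := fun t => (↑) '' {i : M.E | t ≤ l.toLinearMap (Pi.single i 1)} with hG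
    have hGE : ∀ t, G t ⊆ M.E := by rintro t _ ⟨i, -, rfl⟩; exact i.2
    have hGT : ∀ t B, M.IsBase B → baseVec M B ∈ K → Tight M (G t) B := fun t B hB hBK =>
      tight_of_isMax l.toLinearMap hB (hmaxK B hB hBK) t
    have hFG : ∀ t B, M.IsBase B → Tight M F B → Tight M (G t) B := fun t B hB hT =>
      hGT t B hB (hlt.subset ⟨(baseVec_mem_hyperplane_iff hB).2 hT, baseVec_mem hB⟩)
    -- Vertices of `K` are tight on every `G t`. If some `G t` forces tightness on `F`, then `K`
    -- lies in `H(F)`, against strictness; otherwise every base is tight on every `G t`, so `l` is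
    -- constant and `K` is all of `P(M)`.
    by_cases hex : ∃ t, ∀ B, M.IsBase B → Tight M (G t) B → Tight M F B
    · obtain ⟨t, ht⟩ := hex
      refine absurd (fun x hx => ?_) hlt.not_subset
      refine ⟨?_, IsExposed.subset hK hx⟩
      have hx' := hx
      rw [hl] at hx' hB₀K
      have hxm := mem_convexHull_of_eq_max (l := l.toLinearMap) (c := l (baseVec M B₀))
        (finite_setOf_baseVec M) (fun y hy => hB₀K.2 y (subset_convexHull ℝ _ hy)) hx'.1
        (le_antisymm (hB₀K.2 x hx'.1) (hx'.2 _ hB₀K.1))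
      refine convexHull_min ?_ (convex_setOf_hyperplane F) hxm
      rintro _ ⟨⟨B, hB, rfl⟩, he⟩
      have he' : l (baseVec M B) = l (baseVec M B₀) := he
      rw [baseVec_mem_hyperplane_iff hB]
      refine ht B hB (hGT t B hB ?_)
      rw [hl]
      exact ⟨baseVec_mem hB, fun y hy => he' ▸ hB₀K.2 y hy⟩
    · push Not at hex
      have hall : ∀ t B, M.IsBase B → Tight M (G t) B := by
        intro t
        refine (h.2 (G t) (hGE t) (hFG t)).resolve_left fun h' => ?_
        obtain ⟨B, hB, h1, h2⟩ := hex t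
        exact h2 (h' B hB h1)
      refine Subset.antisymm (IsExposed.subset hK) (convexHull_min ?_ hKc)
      rintro _ ⟨B, hB, rfl⟩
      have := map_baseVec_eq_of_forall_tight l.toLinearMap hall _ B₀ B hB₀ hB rfl
      rw [hl] at hB₀K ⊢
      exact ⟨baseVec_mem hB, fun y hy => (hB₀K.2 y hy).trans this.ge⟩

end Functional

lemma isFlacet_of_combFlacet [M.Finite] (h : CombFlacet M F) : IsFlacet M F :=
  ⟨h.isFlat, isFacet_of_combFacet h.isFlat.subset_ground h.facet,
    fun F' hF' he hs => h.minimal F' hF' (hyperplane_inter_eq_iff.1 he) hs⟩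

/-! ### Relative interiors -/

/-- A segment from `p` to a relative interior point can be prolonged beyond it. With `p` a base
vector this gives strict bounds on coordinates. -/
lemma exists_add_smul_sub_mem {V : Type*} [NormedAddCommGroup V] [NormedSpace ℝ V] {S : Set V}
    {x p : V} (hx : x ∈ intrinsicInterior ℝ S) (hp : p ∈ S) :
    ∃ ε : ℝ, 0 < ε ∧ x + ε • (x - p) ∈ S := by
  obtain ⟨⟨y, hy⟩, hyi, rfl⟩ := mem_intrinsicInterior.1 hx
  set c : ℝ → affineSpan ℝ S := fun t => ⟨AffineMap.lineMap y p (-t),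
    AffineMap.lineMap_mem _ hy (subset_affineSpan ℝ S hp)⟩ with hc
  have hcc : Continuous c := by
    refine Continuous.subtype_mk ?_ _
    exact AffineMap.lineMap_continuous.comp continuous_neg
  have hc0 : c 0 = ⟨y, hy⟩ := by simp [hc]
  have hn : c ⁻¹' interior ((↑) ⁻¹' S) ∈ nhds (0 : ℝ) :=
    hcc.continuousAt.preimage_mem_nhds (isOpen_interior.mem_nhds (by rw [hc0]; exact hyi))
  obtain ⟨ε, hε, hball⟩ := Metric.mem_nhds_iff.1 hn
  refine ⟨ε / 2, by linarith, ?_⟩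
  have h1 : (ε / 2) ∈ Metric.ball (0 : ℝ) ε := by
    rw [mem_ball_zero_iff, Real.norm_eq_abs, abs_of_pos] <;> linarith
  have h2 := interior_subset (hball h1)
  have h3 : ((c (ε / 2) : affineSpan ℝ S) : V) = y + (ε / 2) • (y - p) := by
    simp only [hc, AffineMap.lineMap_apply, vsub_eq_sub, vadd_eq_add, neg_smul, smul_sub]
    abel
  rw [← h3]
  exact h2

/-- The intersection of the unit cube with the affine span of the matroid polytope. -/
def slab (M : Matroid α) : Set (M.E → ℝ) :=
  (affineSpan ℝ (basePolytope M) : Set (M.E → ℝ)) ∩ Icc 0 1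

lemma baseVec_mem_slab (hB : M.IsBase B) : baseVec M B ∈ slab M :=
  ⟨subset_affineSpan ℝ _ (baseVec_mem hB), indicator_mem_Icc _⟩

lemma apply_eq_of_mem_affineSpan {x : M.E → ℝ} (hx : x ∈ affineSpan ℝ (basePolytope M)) {e : M.E}
    {c : ℝ} (h : ∀ B, M.IsBase B → baseVec M B e = c) : x e = c := by
  rw [basePolytope_eq, affineSpan_convexHull] at hx
  refine affineSpan_induction (p := fun y : M.E → ℝ => y e = c) hx ?_ ?_
  · rintro _ ⟨B, hB, rfl⟩; exact h B hB
  · intro a u v w hu hv hw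
    simp [hu, hv, hw]

lemma lt_one_of_mem_intrinsicInterior [M.Finite] {x : M.E → ℝ}
    (hx : x ∈ intrinsicInterior ℝ (slab M)) {e : M.E} (hB : M.IsBase B) (he : (e : α) ∉ B) :
    x e < 1 := by
  have := Fintype.ofFinite M.E
  obtain ⟨ε, hε, h⟩ := exists_add_smul_sub_mem hx (baseVec_mem_slab hB)
  have h1 := h.2.2 e
  have h0 := (intrinsicInterior_subset hx).2.1 e
  simp only [Pi.add_apply, Pi.smul_apply, Pi.sub_apply, smul_eq_mul, baseVec_of_notMem he,
    Pi.one_apply, Pi.zero_apply, sub_zero] at h1 h0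
  nlinarith

lemma pos_of_mem_intrinsicInterior [M.Finite] {x : M.E → ℝ}
    (hx : x ∈ intrinsicInterior ℝ (slab M)) {e : M.E} (hB : M.IsBase B) (he : (e : α) ∈ B) :
    0 < x e := by
  have := Fintype.ofFinite M.E
  obtain ⟨ε, hε, h⟩ := exists_add_smul_sub_mem hx (baseVec_mem_slab hB)
  have h1 := h.2.1 e
  have h0 := (intrinsicInterior_subset hx).2.2 e
  simp only [Pi.add_apply, Pi.smul_apply, Pi.sub_apply, smul_eq_mul, baseVec_of_mem he,
    Pi.one_apply, Pi.zero_apply] at h1 h0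
  nlinarith

/-- Coordinates of loops and coloops are constant on the affine span, so their cube bounds hold
automatically. The remaining bounds are strict at `x` and define an open set. -/
lemma mem_intrinsicInterior_slab [M.Finite] {x : M.E → ℝ}
    (hx : x ∈ affineSpan ℝ (basePolytope M))
    (h1 : ∀ e : M.E, ∀ B, M.IsBase B → (e : α) ∉ B → x e < 1)
    (h0 : ∀ e : M.E, ∀ B, M.IsBase B → (e : α) ∈ B → 0 < x e) :
    x ∈ intrinsicInterior ℝ (slab M) := by
  set U : Set (M.E → ℝ) := {y | ∀ e : M.E, ((∃ B, M.IsBase B ∧ (e : α) ∉ B) → y e < 1) ∧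
    ((∃ B, M.IsBase B ∧ (e : α) ∈ B) → 0 < y e)} with hU
  have hUo : IsOpen U := by
    simp only [hU, Set.ofPred_forall]
    refine isOpen_iInter_of_finite fun e => ?_
    rw [Set.ofPred_and]
    refine IsOpen.inter ?_ ?_
    · by_cases h : ∃ B, M.IsBase B ∧ (e : α) ∉ B
      · simp only [h, true_imp_iff]
        exact isOpen_lt (continuous_apply e) continuous_const
      · simp [h]
    · by_cases h : ∃ B, M.IsBase B ∧ (e : α) ∈ B
      · simp only [h, true_imp_iff]
        exact isOpen_lt continuous_const (continuous_apply e)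
      · simp [h]
  have hsub : ∀ y ∈ affineSpan ℝ (basePolytope M), y ∈ U → y ∈ slab M := by
    intro y hy hyU
    obtain ⟨B, hB⟩ := M.exists_isBase
    refine ⟨hy, fun e => ?_, fun e => ?_⟩
    · by_cases h : ∃ B, M.IsBase B ∧ (e : α) ∈ B
      · exact ((hyU e).2 h).le
      · push Not at h
        rw [apply_eq_of_mem_affineSpan hy fun B hB => baseVec_of_notMem (h B hB)]
        exact le_rfl
    · by_cases h : ∃ B, M.IsBase B ∧ (e : α) ∉ B
      · exact ((hyU e).1 h).le
      · push Not at h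
        rw [apply_eq_of_mem_affineSpan hy fun B hB => baseVec_of_mem (h B hB)]
        exact le_rfl
  have hxU : x ∈ U := fun e => ⟨fun ⟨B, hB, he⟩ => h1 e B hB he, fun ⟨B, hB, he⟩ => h0 e B hB he⟩
  have hle : affineSpan ℝ (slab M) ≤ affineSpan ℝ (basePolytope M) :=
    affineSpan_le.2 inter_subset_left
  rw [mem_intrinsicInterior]
  refine ⟨⟨x, subset_affineSpan ℝ _ (hsub x hx hxU)⟩, ?_, rfl⟩
  have hsub' : ((↑) ⁻¹' U : Set (affineSpan ℝ (slab M))) ⊆ (↑) ⁻¹' slab M :=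
    fun y hy => hsub y (hle y.2) hy
  exact interior_maximal hsub' (hUo.preimage continuous_subtype_val) hxU

/-! ### Points of `H(F)` -/

lemma baseVec_loop_eq_zero (hB : M.IsBase B) {e : M.E} (he : (e : α) ∈ M.loops) :
    baseVec M B e = 0 :=
  baseVec_of_notMem fun h => hB.indep.disjoint_loops.le_bot ⟨h, he⟩

lemma apply_loop_eq_zero {x : M.E → ℝ} (hx : x ∈ affineSpan ℝ (basePolytope M)) {e : M.E}
    (he : (e : α) ∈ M.loops) : x e = 0 :=
  apply_eq_of_mem_affineSpan hx fun _ hB => baseVec_loop_eq_zero hB he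

lemma rk_diff_loops (M : Matroid α) (F : Set α) : rk M (F \ M.loops) = rk M F := by
  unfold rk
  rw [Matroid.eRk_eq_eRk_sdiff_eRk_le_zero F (by rw [Matroid.eRk_loops])]

lemma coordSum_diff_loops [M.Finite] {x : M.E → ℝ} (hx : x ∈ affineSpan ℝ (basePolytope M)) :
    coordSum ((↑) ⁻¹' (F \ M.loops) : Set M.E) x = coordSum ((↑) ⁻¹' F : Set M.E) x := by
  rw [coordSum_apply, coordSum_apply, finsum_mem_def, finsum_mem_def]
  congr 1
  funext i
  by_cases hl : (i : α) ∈ M.loops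
  · rw [indicator_of_notMem (by simp [hl])]
    by_cases hF : (i : α) ∈ F
    · rw [indicator_of_mem (by exact hF), apply_loop_eq_zero hx hl]
    · rw [indicator_of_notMem (by exact hF)]
  · by_cases hF : (i : α) ∈ F
    · rw [indicator_of_mem (by exact ⟨hF, hl⟩), indicator_of_mem (by exact hF)]
    · rw [indicator_of_notMem (fun h => hF h.1), indicator_of_notMem (by exact hF)]

/-- With no nonloop, every base would be tight. With a single nonloop `e`, the hyperplane gives `x e
= 1`, while a non-tight base misses `e` and forces `x e < 1`. -/
lemma CombFlacet.nontrivial_of_mem_intrinsicInterior [M.Finite] (hF : CombFlacet M F)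
    {x : M.E → ℝ} (hx : x ∈ intrinsicInterior ℝ (slab M)) (hxF : x ∈ hyperplane M F) :
    (F \ M.loops).Nontrivial := by
  rw [← not_subsingleton_iff]
  intro hsub
  obtain ⟨B, hB, hT⟩ := hF.facet.1
  have hxA := (intrinsicInterior_subset hx).1
  have hlt := lt_of_le_of_ne (ncard_inter_le_rk (F := F) hB) hT
  rcases hsub.eq_empty_or_singleton with h | ⟨e, h⟩
  · rw [← rk_diff_loops, h] at hlt
    simp [rk] at hlt
  · have he : e ∈ F \ M.loops := h ▸ rfl
    have heE := hF.isFlat.subset_ground he.1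
    have hnl : M.IsNonloop e := (M.isNonloop_iff_notMem_loops heE).2 he.2
    have hrk : rk M F = 1 := by
      rw [← rk_diff_loops, h, rk, hnl.eRk_eq]; rfl
    rw [hrk, Nat.lt_one_iff, ncard_eq_zero (hB.finite.subset inter_subset_left)] at hlt
    have heB : e ∉ B := fun h' => hlt.subset ⟨h', he.1⟩
    have := lt_one_of_mem_intrinsicInterior hx (e := ⟨e, heE⟩) hB heB
    rw [mem_hyperplane_iff, ← coordSum_diff_loops hxA, h, hrk] at hxF
    have h2 : ((↑) ⁻¹' {e} : Set M.E) = {⟨e, heE⟩} := by ext i; simp [Subtype.ext_iff]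
    rw [h2, coordSum_apply, finsum_mem_singleton] at hxF
    rw [hxF] at this
    simp at this

/-! ### A combinatorial criterion -/

/-- A non-tight base gives `0 < r(F)` and `r - r(F) < |E \ F|`. If `r(F) = |F|`, the nonloops would
be independent, against `CombFlacet.mem_closure`; if `r(F) = r`, the flat `F` would be `E`, on which
all bases are tight. -/
lemma CombFlacet.isSplitHyperplane [M.Finite] (hF : CombFlacet M F)
    (hnt : (F \ M.loops).Nontrivial) :
    IsSplitHyperplane (hypersimplex (rk M M.E) M.E)
      (affineSpan ℝ (hyperplane M F ∩ hypersimplex (rk M M.E) M.E)) := by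
  have hFE := hF.isFlat.subset_ground
  have hA := ncard_preimage_ground hFE
  have hAc : ((↑) ⁻¹' F : Set M.E)ᶜ.ncard = (M.E \ F).ncard := by
    rw [← ncard_preimage_ground (sdiff_subset : M.E \ F ⊆ M.E)]
    congr 1
    ext i
    simp
  obtain ⟨B₀, hB₀, hT₀⟩ := exists_tight (M := M) hFE
  have hr : ∀ {B}, M.IsBase B → B.ncard = rk M M.E := fun hB =>
    ncard_eq_rk (M.isBasis_ground_iff.2 hB)
  obtain ⟨B, hB, hT⟩ := hF.facet.1
  obtain ⟨a, ha⟩ := hnt.nonempty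
  have haE := hFE ha.1
  have e₀ := ncard_inter_add_diff hB₀.indep F
  have e₁ := ncard_inter_add_diff hB.indep F
  have hlt := lt_of_le_of_ne (ncard_inter_le_rk (F := F) hB) hT
  rw [hr hB₀] at e₀
  rw [hr hB] at e₁
  unfold Tight at hT₀
  refine isSplitHyperplane_hypersimplex (A := ((↑) ⁻¹' F : Set M.E)) (k := rk M F) ?_ ?_ ?_ ?_
  · omega
  · rw [hA]
    have hle := ncard_le_ncard (inter_subset_right : B₀ ∩ F ⊆ F) (M.set_finite F hFE)
    refine lt_of_le_of_ne (hT₀ ▸ hle) fun he => ?_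
    have h1 : B₀ ∩ F = F :=
      eq_of_subset_of_ncard_le inter_subset_right (by omega) (M.set_finite F hFE)
    have h2 : M.Indep (F \ M.loops) :=
      hB₀.indep.subset (sdiff_subset.trans (inter_eq_right.1 h1))
    exact h2.notMem_closure_sdiff_of_mem ha (hF.mem_closure hnt ha)
  · refine lt_of_le_of_ne (by omega) fun he => ?_
    have h1 : (B₀ \ F).ncard = 0 := by omega
    rw [ncard_eq_zero hB₀.finite.sdiff, sdiff_eq_empty] at h1
    have h2 : F = M.E := by
      refine hFE.antisymm ?_
      rw [← hB₀.closure_eq, ← hF.isFlat.closure]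
      exact M.closure_subset_closure h1
    rw [h2, inter_eq_self_of_subset_left hB.subset_ground, hr hB] at hlt
    exact lt_irrefl _ hlt
  · rw [hAc]
    have := ncard_le_ncard (sdiff_subset_sdiff_left hB.subset_ground : B \ F ⊆ M.E \ F)
      (M.set_finite _ sdiff_subset)
    omega

theorem not_isSplitMatroid_iff [M.Finite] :
    ¬ IsSplitMatroid M ↔ ∃ F₁ F₂ : Set α, ∃ x : M.E → ℝ, F₁ ≠ F₂ ∧ CombFlacet M F₁ ∧
      CombFlacet M F₂ ∧ x ∈ intrinsicInterior ℝ (slab M) ∧ x ∈ hyperplane M F₁ ∧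
      x ∈ hyperplane M F₂ := by
  unfold IsSplitMatroid
  push Not
  constructor
  · rintro ⟨F₁, F₂, h₁, h₂, hne, x, hx, hxi⟩
    exact ⟨F₁, F₂, x, hne, combFlacet_of_isFlacet h₁.1, combFlacet_of_isFlacet h₂.1, hxi, hx.1,
      hx.2⟩
  · rintro ⟨F₁, F₂, x, hne, h₁, h₂, hxi, hx₁, hx₂⟩
    exact ⟨F₁, F₂,
      ⟨isFlacet_of_combFlacet h₁,
        h₁.isSplitHyperplane (h₁.nontrivial_of_mem_intrinsicInterior hxi hx₁)⟩,
      ⟨isFlacet_of_combFlacet h₂,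
        h₂.isSplitHyperplane (h₂.nontrivial_of_mem_intrinsicInterior hxi hx₂)⟩,
      hne, x, ⟨hx₁, hx₂⟩, hxi⟩

/-! ### Restriction to a union of components -/

lemma tight_diff_loops_iff (hB : M.IsBase B) : Tight M (F \ M.loops) B ↔ Tight M F B := by
  have : B ∩ (F \ M.loops) = B ∩ F := by
    rw [← inter_sdiff_assoc, sdiff_eq_left]
    exact hB.indep.disjoint_loops.mono_left inter_subset_left
  rw [Tight, Tight, rk_diff_loops, this]

lemma tight_congr_diff_loops (hB : M.IsBase B) (h : F \ M.loops = G \ M.loops) :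
    Tight M F B ↔ Tight M G B := by
  rw [← tight_diff_loops_iff hB, h, tight_diff_loops_iff hB]

lemma restrict_finite_of_subset [M.Finite] (hS : S ⊆ M.E) : (M ↾ S).Finite :=
  Matroid.restrict_finite (M.set_finite S hS)

lemma rk_restrict (h : F ⊆ S) : rk (M ↾ S) F = rk M F := by
  rw [rk, rk, Matroid.restrict_eRk_eq M h]

lemma tight_ground [M.Finite] (hB : M.IsBase B) : Tight M M.E B := by
  rw [Tight, inter_eq_self_of_subset_left hB.subset_ground]
  exact ncard_eq_rk (M.isBasis_ground_iff.2 hB)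

lemma Splits.isBase_inter [M.Finite] (h : Splits M M.E S) (hS : S ⊆ M.E) (hB : M.IsBase B) :
    (M ↾ S).IsBase (B ∩ S) := by
  rw [Matroid.isBase_restrict_iff hS]
  exact (h.tight hS subset_rfl hB (tight_ground hB)).isBasis hB hS

lemma exists_isBase_inter_eq (hS : S ⊆ M.E) (hB : (M ↾ S).IsBase B) :
    ∃ B', M.IsBase B' ∧ B = B' ∩ S := by
  rw [Matroid.isBase_restrict_iff hS] at hB
  exact hB.exists_isBase

lemma tight_restrict_iff (hF : F ⊆ S) : Tight (M ↾ S) F (B ∩ S) ↔ Tight M F B := by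
  rw [Tight, Tight, rk_restrict hF, inter_assoc, inter_eq_self_of_subset_right hF]

lemma restrict_loops_eq (hS : S ⊆ M.E) : (M ↾ S).loops = M.loops ∩ S := by
  rw [← Matroid.closure_empty, ← Matroid.closure_empty,
    Matroid.restrict_closure_eq M (empty_subset S) hS]

lemma CombFlacet.restrict [M.Finite] (hF : CombFlacet M F) (hS : S ⊆ M.E) (h : Splits M M.E S)
    (hFS : F \ M.loops ⊆ S) : CombFlacet (M ↾ S) (F ∩ S) := by
  have hFE := hF.isFlat.subset_ground
  have hdl : (F ∩ S) \ M.loops = F \ M.loops := by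
    ext x
    exact ⟨fun hx => ⟨hx.1.1, hx.2⟩, fun hx => ⟨⟨hx.1, hFS hx⟩, hx.2⟩⟩
  have hT : ∀ {B}, M.IsBase B → (Tight (M ↾ S) (F ∩ S) (B ∩ S) ↔ Tight M F B) := fun hB => by
    rw [tight_restrict_iff inter_subset_right, tight_congr_diff_loops hB hdl]
  refine ⟨?_, ⟨?_, ?_⟩, ?_⟩
  · rw [Matroid.isFlat_iff_closure_eq, Matroid.restrict_closure_eq M inter_subset_right hS]
    refine Subset.antisymm (inter_subset_inter_left _ ?_)
      (subset_inter (M.subset_closure _ (inter_subset_left.trans hFE)) inter_subset_right)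
    have := M.closure_subset_closure (inter_subset_left : F ∩ S ⊆ F)
    rwa [hF.isFlat.closure] at this
  · obtain ⟨B, hB, hnT⟩ := hF.facet.1
    exact ⟨B ∩ S, h.isBase_inter hS hB, fun h' => hnT ((hT hB).1 h')⟩
  · intro G hGS hFG
    have hGS : G ⊆ S := hGS
    have key := hF.facet.2 G (hGS.trans hS) fun B hB hTB =>
      (tight_restrict_iff hGS).1 (hFG _ (h.isBase_inter hS hB) ((hT hB).2 hTB))
    rcases key with key | key
    · left
      intro B' hB' hTB
      obtain ⟨B, hB, rfl⟩ := exists_isBase_inter_eq hS hB'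
      exact (hT hB).2 (key B hB ((tight_restrict_iff hGS).1 hTB))
    · right
      intro B' hB'
      obtain ⟨B, hB, rfl⟩ := exists_isBase_inter_eq hS hB'
      exact (tight_restrict_iff hGS).2 (key B hB)
  · intro F' hF' hTF' hF'F
    have hF'S : F' ⊆ S := hF'F.trans inter_subset_right
    have hF'E := hF'S.trans hS
    have hcl : M.closure F' ∩ S = F' := by
      rw [← Matroid.restrict_closure_eq M hF'S hS]; exact hF'.closure
    -- A flat of the restriction becomes a flat of `M` once all loops are added: by the separator,
    -- its closure gains only loops outside `S`.
    have hflat : M.IsFlat (F' ∪ M.loops) := by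
      rw [Matroid.isFlat_iff_closure_eq]
      refine Subset.antisymm (fun e he => ?_)
        (M.subset_closure _ (union_subset hF'E M.loops_subset_ground))
      rw [← Matroid.closure_empty, Matroid.closure_union_closure_right_eq, union_empty] at he
      by_cases heS : e ∈ S
      · exact Or.inl (hcl.subset ⟨he, heS⟩)
      · right
        by_contra hel
        have heE := M.closure_subset_ground _ he
        have hei : M.Indep {e} := by
          rw [Matroid.indep_singleton]
          exact (M.isNonloop_iff_notMem_loops heE).2 hel
        obtain ⟨J, hJ⟩ := M.exists_isBasis F'
        have hi := h hJ.indep hei (hJ.subset.trans hF'S) (by simpa using heE) (by simpa using heS)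
        rw [← hJ.closure_eq_closure, hJ.indep.mem_closure_iff'] at he
        exact heS (hF'S (hJ.subset (he.2 (by rwa [union_singleton] at hi))))
    have heq := hF.minimal _ hflat (fun B hB => ?_)
      (union_subset (hF'F.trans inter_subset_left) hF.isFlat.loops_subset)
    · refine Subset.antisymm hF'F fun x hx => ?_
      rcases (heq.symm.subset hx.1) with h' | h'
      · exact h'
      · refine hF'.loops_subset ?_
        rw [restrict_loops_eq hS]
        exact ⟨h', hx.2⟩
    · rw [← hT hB, ← hTF' _ (h.isBase_inter hS hB), tight_restrict_iff hF'S]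
      exact tight_congr_diff_loops hB (by rw [union_sdiff_right])

/-- Forgetting the coordinates outside `S` keeps the witness: bases restrict to bases, strict bounds
persist, and the two sums involve only coordinates in `S` and loops, which vanish. -/
lemma not_isSplitMatroid_restrict [M.Finite] (hS : S ⊆ M.E) (h : Splits M M.E S) {F₁ F₂ : Set α}
    {x : M.E → ℝ} (hne : F₁ ≠ F₂) (h₁ : CombFlacet M F₁) (h₂ : CombFlacet M F₂)
    (hx : x ∈ intrinsicInterior ℝ (slab M)) (hx₁ : x ∈ hyperplane M F₁)
    (hx₂ : x ∈ hyperplane M F₂) (hs₁ : F₁ \ M.loops ⊆ S) (hs₂ : F₂ \ M.loops ⊆ S) :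
    ¬ IsSplitMatroid (M ↾ S) := by
  have := restrict_finite_of_subset hS
  rw [not_isSplitMatroid_iff]
  set ι : (M ↾ S).E → M.E := fun i => ⟨i, hS i.2⟩ with hι
  have hιi : Function.Injective ι := fun i j hij =>
    Subtype.ext (congrArg (fun z : M.E => (z : α)) hij)
  have hbv : ∀ {B}, M.IsBase B → baseVec M B ∘ ι = baseVec (M ↾ S) (B ∩ S) := by
    intro B hB
    funext i
    by_cases hi : (i : α) ∈ B
    · rw [baseVec_of_mem (show (i : α) ∈ B ∩ S from ⟨hi, i.2⟩)]
      exact baseVec_of_mem (e := ι i) hi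
    · rw [baseVec_of_notMem (fun h => hi h.1)]
      exact baseVec_of_notMem (e := ι i) hi
  have hxA := (intrinsicInterior_subset hx).1
  have hxA' : x ∘ ι ∈ affineSpan ℝ (basePolytope (M ↾ S)) := by
    have hxA₂ := hxA
    rw [basePolytope_eq, affineSpan_convexHull] at hxA₂
    refine affineSpan_induction
      (p := fun y : M.E → ℝ => y ∘ ι ∈ affineSpan ℝ (basePolytope (M ↾ S))) hxA₂ ?_ ?_
    · rintro _ ⟨B, hB, rfl⟩
      rw [hbv hB]
      exact subset_affineSpan ℝ _ (baseVec_mem (h.isBase_inter hS hB))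
    · intro c u v w hu hv hw
      exact AffineSubspace.smul_vsub_vadd_mem _ c hu hv hw
  have hH : ∀ {F}, CombFlacet M F → F \ M.loops ⊆ S → x ∈ hyperplane M F →
      x ∘ ι ∈ hyperplane (M ↾ S) (F ∩ S) := by
    intro F hF hFS hxF
    have hdl : (F ∩ S) \ M.loops = F \ M.loops := by
      ext x
      exact ⟨fun hx => ⟨hx.1.1, hx.2⟩, fun hx => ⟨⟨hx.1, hFS hx⟩, hx.2⟩⟩
    rw [mem_hyperplane_iff, rk_restrict inter_subset_right, ← rk_diff_loops, hdl, rk_diff_loops,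
      ← mem_hyperplane_iff.1 hxF, ← coordSum_diff_loops hxA, ← hdl, coordSum_diff_loops hxA]
    have him : ι '' ((↑) ⁻¹' (F ∩ S) : Set (M ↾ S).E) = ((↑) ⁻¹' (F ∩ S) : Set M.E) := by
      ext j
      constructor
      · rintro ⟨i, hi, rfl⟩; exact hi
      · intro hj; exact ⟨⟨j, hj.2⟩, hj, rfl⟩
    rw [coordSum_apply, coordSum_apply, ← him, finsum_mem_image hιi.injOn]
    rfl
  refine ⟨F₁ ∩ S, F₂ ∩ S, x ∘ ι, fun he => hne ?_, h₁.restrict hS h hs₁, h₂.restrict hS h hs₂,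
    mem_intrinsicInterior_slab hxA' ?_ ?_, hH h₁ hs₁ hx₁, hH h₂ hs₂ hx₂⟩
  · have key : ∀ {F F'}, CombFlacet M F → CombFlacet M F' → F \ M.loops ⊆ S → F ∩ S = F' ∩ S →
        F ⊆ F' := by
      intro F F' _ hF' hFS he x hxF
      by_cases hl : x ∈ M.loops
      · exact hF'.isFlat.loops_subset hl
      · exact (he.subset ⟨hxF, hFS ⟨hxF, hl⟩⟩).1
    exact Subset.antisymm (key h₁ h₂ hs₁ he) (key h₂ h₁ hs₂ he.symm)
  · intro e B' hB' heB'
    obtain ⟨B, hB, rfl⟩ := exists_isBase_inter_eq hS hB'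
    exact lt_one_of_mem_intrinsicInterior hx (e := ι e) hB fun h => heB' ⟨h, e.2⟩
  · intro e B' hB' heB'
    obtain ⟨B, hB, rfl⟩ := exists_isBase_inter_eq hS hB'
    exact pos_of_mem_intrinsicInterior hx (e := ι e) hB heB'.1

/-! ### Labellings by `S₀` -/

/-- The maps `g` and `h` identify `M` with the direct sum of two copies of `M(𝒲₂)`. -/
structure S0Labelling (M : Matroid α) (g h : Fin 4 → α) : Prop where
  inj_left : Function.Injective g
  inj_right : Function.Injective h
  disjoint : Disjoint (range g) (range h)
  ground_eq : M.E = range g ∪ range h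
  indep_iff : ∀ J K : Set (Fin 4), M.Indep (g '' J ∪ h '' K) ↔ MW2Indep J ∧ MW2Indep K

lemma MW2Indep.exists_superset {J : Set (Fin 4)} (hJ : MW2Indep J) :
    J.ncard ≤ 2 ∧ ∃ J', J ⊆ J' ∧ MW2Indep J' ∧ J'.ncard = 2 := by
  lift J to Finset (Fin 4) using J.toFinite
  have key : ∀ J : Finset (Fin 4),
      (¬ (0 ∈ J ∧ 1 ∈ J) ∧ ¬ (0 ∈ J ∧ 2 ∈ J ∧ 3 ∈ J) ∧ ¬ (1 ∈ J ∧ 2 ∈ J ∧ 3 ∈ J)) →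
      J.card ≤ 2 ∧ ∃ J' : Finset (Fin 4), J ⊆ J' ∧
        (¬ (0 ∈ J' ∧ 1 ∈ J') ∧ ¬ (0 ∈ J' ∧ 2 ∈ J' ∧ 3 ∈ J') ∧ ¬ (1 ∈ J' ∧ 2 ∈ J' ∧ 3 ∈ J')) ∧
        J'.card = 2 := by decide
  obtain ⟨h1, J', h2, h3, h4⟩ := key J hJ
  exact ⟨by rwa [ncard_coe_finset], J', by exact_mod_cast h2, h3, by rwa [ncard_coe_finset]⟩

/-- A base of `M(𝒲₂)`. -/
def MW2Base (J : Set (Fin 4)) : Prop := MW2Indep J ∧ J.ncard = 2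

lemma MW2Base.eq_or_exists {J : Set (Fin 4)} (hJ : MW2Base J) :
    J = {2, 3} ∨ (J ∩ {0, 1}).ncard = 1 := by
  lift J to Finset (Fin 4) using J.toFinite
  have key : ∀ J : Finset (Fin 4),
      (¬ (0 ∈ J ∧ 1 ∈ J) ∧ ¬ (0 ∈ J ∧ 2 ∈ J ∧ 3 ∈ J) ∧ ¬ (1 ∈ J ∧ 2 ∈ J ∧ 3 ∈ J)) →
      J.card = 2 → J = {2, 3} ∨ (J ∩ {0, 1}).card = 1 := by decide
  have h2 := hJ.2
  rw [ncard_coe_finset] at h2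
  rcases key J hJ.1 h2 with h | h
  · left; rw [h]; simp
  · right
    rw [← h, ← ncard_coe_finset]
    simp

lemma mw2Base_pair {i j : Fin 4} (hij : i ≠ j) (h : ({i, j} : Set (Fin 4)) ≠ {0, 1}) :
    MW2Base {i, j} := by
  refine ⟨?_, ncard_pair hij⟩
  rw [Ne, Set.ext_iff, Fin.forall_fin_succ] at h
  simp only [MW2Indep, mem_insert_iff, mem_singleton_iff] at *
  fin_cases i <;> fin_cases j <;> simp_all [Fin.forall_fin_succ]

namespace S0Labelling

variable {g h : Fin 4 → α}

lemma symm (H : S0Labelling M g h) : S0Labelling M h g :=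
  ⟨H.inj_right, H.inj_left, H.disjoint.symm, by rw [H.ground_eq, union_comm],
    fun J K => by rw [union_comm, H.indep_iff, and_comm]⟩

lemma left_mem_iff (H : S0Labelling M g h) {J K : Set (Fin 4)} {i : Fin 4} :
    g i ∈ g '' J ∪ h '' K ↔ i ∈ J := by
  rw [mem_union, H.inj_left.mem_set_image, or_iff_left]
  rintro ⟨k, -, hk⟩
  exact H.disjoint.le_bot ⟨mem_range_self i, hk ▸ mem_range_self k⟩

lemma right_mem_iff (H : S0Labelling M g h) {J K : Set (Fin 4)} {i : Fin 4} :
    h i ∈ g '' J ∪ h '' K ↔ i ∈ K := by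
  rw [union_comm]; exact H.symm.left_mem_iff

lemma exists_eq (H : S0Labelling M g h) (hI : I ⊆ M.E) : I = g '' (g ⁻¹' I) ∪ h '' (h ⁻¹' I) := by
  rw [image_preimage_eq_inter_range, image_preimage_eq_inter_range, ← inter_union_distrib_left,
    ← H.ground_eq, inter_eq_self_of_subset_left hI]

lemma isBase_iff (H : S0Labelling M g h) :
    M.IsBase B ↔ ∃ J K, MW2Base J ∧ MW2Base K ∧ B = g '' J ∪ h '' K := by
  constructor
  · intro hB
    have hBE := H.exists_eq hB.subset_ground
    have hi := hB.indep
    rw [hBE, H.indep_iff] at hi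
    obtain ⟨-, J, hJ, hJi, hJc⟩ := hi.1.exists_superset
    obtain ⟨-, K, hK, hKi, hKc⟩ := hi.2.exists_superset
    refine ⟨J, K, ⟨hJi, hJc⟩, ⟨hKi, hKc⟩, hB.eq_of_subset_indep ((H.indep_iff J K).2 ⟨hJi, hKi⟩) ?_⟩
    rw [hBE]
    exact union_subset_union (image_mono hJ) (image_mono hK)
  · rintro ⟨J, K, hJ, hK, rfl⟩
    refine ((H.indep_iff J K).2 ⟨hJ.1, hK.1⟩).isBase_of_maximal fun I hI hs => ?_
    have hIE := H.exists_eq hI.subset_ground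
    have hIi := hI
    rw [hIE, H.indep_iff] at hIi
    have h1 : J = g ⁻¹' I := eq_of_subset_of_ncard_le
      (fun i hi => hs (H.left_mem_iff.2 hi)) (hJ.2 ▸ hIi.1.exists_superset.1) (toFinite _)
    have h2 : K = h ⁻¹' I := eq_of_subset_of_ncard_le
      (fun i hi => hs (H.right_mem_iff.2 hi)) (hK.2 ▸ hIi.2.exists_superset.1) (toFinite _)
    rw [h1, h2, ← hIE]

lemma ncard_inter (H : S0Labelling M g h) (J K : Set (Fin 4)) (G : Set α) :
    ((g '' J ∪ h '' K) ∩ G).ncard = (J ∩ g ⁻¹' G).ncard + (K ∩ h ⁻¹' G).ncard := by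
  rw [union_inter_distrib_right, ← image_inter_preimage, ← image_inter_preimage,
    ncard_union_eq (H.disjoint.mono (image_subset_range _ _) (image_subset_range _ _))
      ((toFinite _).image _) ((toFinite _).image _),
    ncard_image_of_injective _ H.inj_left, ncard_image_of_injective _ H.inj_right]

lemma finite (H : S0Labelling M g h) : M.Finite :=
  ⟨by rw [H.ground_eq]; exact (finite_range g).union (finite_range h)⟩

lemma ncard_inter_pair (H : S0Labelling M g h) (J K : Set (Fin 4)) :
    ((g '' J ∪ h '' K) ∩ g '' {0, 1}).ncard = (J ∩ {0, 1}).ncard := by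
  have h0 : h ⁻¹' (g '' {0, 1}) = ∅ := by
    refine eq_empty_of_forall_notMem fun k hk => ?_
    exact H.disjoint.le_bot ⟨image_subset_range _ _ hk, mem_range_self k⟩
  rw [H.ncard_inter, preimage_image_eq _ H.inj_left, h0, inter_empty, ncard_empty, add_zero]

lemma isBase_pairs (H : S0Labelling M g h) {i j k l : Fin 4} (hij : i ≠ j)
    (hij' : ({i, j} : Set (Fin 4)) ≠ {0, 1}) (hkl : k ≠ l) (hkl' : ({k, l} : Set (Fin 4)) ≠ {0, 1}) :
    M.IsBase (g '' {i, j} ∪ h '' {k, l}) :=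
  H.isBase_iff.2 ⟨_, _, mw2Base_pair hij hij', mw2Base_pair hkl hkl', rfl⟩

lemma image_left_subset (H : S0Labelling M g h) (J : Set (Fin 4)) : g '' J ⊆ M.E := by
  rw [H.ground_eq]
  exact (image_subset_range _ _).trans subset_union_left

lemma pair_inter_pair_two_three : (({2, 3} : Set (Fin 4)) ∩ {0, 1}).ncard = 0 := by
  rw [show (({2, 3} : Set (Fin 4)) ∩ {0, 1}) = ∅ by ext i; fin_cases i <;> simp, ncard_empty]

lemma rk_left (H : S0Labelling M g h) : rk M (g '' {0, 1}) = 1 := by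
  have := H.finite
  refine le_antisymm ?_ ?_
  · obtain ⟨B, hB, hT⟩ := exists_tight (H.image_left_subset {0, 1})
    obtain ⟨J, K, hJ, -, rfl⟩ := H.isBase_iff.1 hB
    rw [← hT, H.ncard_inter_pair]
    rcases hJ.eq_or_exists with rfl | h1
    · rw [pair_inter_pair_two_three]; simp
    · exact h1.le
  · have := ncard_inter_le_rk (F := g '' {0, 1}) (H.isBase_pairs (i := 0) (j := 2) (k := 0) (l := 2)
      (by decide) (by simp [Set.ext_iff, Fin.forall_fin_succ]) (by decide)
      (by simp [Set.ext_iff, Fin.forall_fin_succ]))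
    rw [H.ncard_inter_pair] at this
    rwa [show (({0, 2} : Set (Fin 4)) ∩ {0, 1}) = {0} by ext i; fin_cases i <;> simp,
      ncard_singleton] at this

lemma tight_left_iff (H : S0Labelling M g h) {J K : Set (Fin 4)} (hJ : MW2Base J) :
    Tight M (g '' {0, 1}) (g '' J ∪ h '' K) ↔ J ≠ {2, 3} := by
  rw [Tight, H.ncard_inter_pair, H.rk_left]
  constructor
  · rintro h1 rfl
    rw [pair_inter_pair_two_three] at h1
    lia
  · intro h1
    exact hJ.eq_or_exists.resolve_left h1

lemma mw2Base_zero_two : MW2Base {0, 2} :=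
  mw2Base_pair (by decide) (by simp [Set.ext_iff, Fin.forall_fin_succ])

lemma mw2Base_one_three : MW2Base {1, 3} :=
  mw2Base_pair (by decide) (by simp [Set.ext_iff, Fin.forall_fin_succ])

lemma mw2Base_one_two : MW2Base {1, 2} :=
  mw2Base_pair (by decide) (by simp [Set.ext_iff, Fin.forall_fin_succ])

lemma mw2Base_two_three : MW2Base {2, 3} :=
  mw2Base_pair (by decide) (by simp [Set.ext_iff, Fin.forall_fin_succ])

lemma isFlat_left (H : S0Labelling M g h) : M.IsFlat (g '' {0, 1}) := by
  have := H.finite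
  have hFE := H.image_left_subset {0, 1}
  have hind : ∀ {J K : Set (Fin 4)}, MW2Indep J → MW2Indep K → M.Indep (g '' J ∪ h '' K) :=
    fun hJ hK => (H.indep_iff _ _).2 ⟨hJ, hK⟩
  have h0 : M.IsBasis (g '' {0}) (g '' {0, 1}) := by
    refine isBasis_of_rk_le ?_ (image_mono (by simp)) hFE ?_
    · refine (hind mw2Base_zero_two.1 mw2Base_zero_two.1).subset ?_
      exact (image_mono (by simp)).trans subset_union_left
    · rw [H.rk_left, ncard_image_of_injective _ H.inj_left, ncard_singleton]
  rw [Matroid.isFlat_iff_closure_eq]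
  refine Subset.antisymm (fun e he => ?_) (M.subset_closure _ hFE)
  rw [← h0.closure_eq_closure, h0.indep.mem_closure_iff'] at he
  have hgz : ∀ {A : Set α}, M.Indep A → insert e (g '' {0}) ⊆ A → e ∈ g '' {0, 1} :=
    fun hA hs => image_mono (by simp) (he.2 (hA.subset hs))
  rcases H.ground_eq.subset he.1 with ⟨i, rfl⟩ | ⟨k, rfl⟩
  · have key : ∀ j : Fin 4, j = 2 ∨ j = 3 → MW2Base {0, j} := by
      rintro j (rfl | rfl) <;>
      exact mw2Base_pair (by decide) (by simp [Set.ext_iff, Fin.forall_fin_succ])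
    by_cases hi : i = 2 ∨ i = 3
    · refine hgz (hind (key i hi).1 mw2Base_zero_two.1) ?_
      rintro _ (rfl | ⟨_, rfl, rfl⟩) <;> exact H.left_mem_iff.2 (by simp)
    · exact mem_image_of_mem g (by fin_cases i <;> simp_all)
  · have : ∃ K : Set (Fin 4), MW2Base K ∧ k ∈ K := by
      fin_cases k
      exacts [⟨_, mw2Base_zero_two, by simp⟩, ⟨_, mw2Base_one_two, by simp⟩,
        ⟨_, mw2Base_zero_two, by simp⟩, ⟨_, mw2Base_one_three, by simp⟩]
    obtain ⟨K, hK, hkK⟩ := this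
    refine hgz (hind mw2Base_zero_two.1 hK.1) ?_
    rintro _ (rfl | ⟨_, rfl, rfl⟩)
    · exact H.right_mem_iff.2 hkK
    · exact H.left_mem_iff.2 (by simp)

/-- Only the bases using `{2, 3}` on the left fail to be tight. The count on `G` is additive over
the two sides, and its right-hand part is the same for all `K`; so these bases are all tight on `G`
or all not. -/
lemma combFacet_left (H : S0Labelling M g h) : CombFacet M (g '' {0, 1}) := by
  refine ⟨⟨_, H.isBase_iff.2 ⟨_, _, mw2Base_two_three, mw2Base_zero_two, rfl⟩, ?_⟩, fun G _ hG => ?_⟩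
  · rw [H.tight_left_iff mw2Base_two_three]; simp
  · have hcd : ∀ J K, MW2Base J → MW2Base K → J ≠ {2, 3} →
        (J ∩ g ⁻¹' G).ncard + (K ∩ h ⁻¹' G).ncard = rk M G := by
      intro J K hJ hK hne
      rw [← H.ncard_inter]
      exact hG _ (H.isBase_iff.2 ⟨J, K, hJ, hK, rfl⟩) ((H.tight_left_iff hJ).2 hne)
    have h02 : ({0, 2} : Set (Fin 4)) ≠ {2, 3} := by simp [Set.ext_iff, Fin.forall_fin_succ]
    by_cases hc : (({2, 3} : Set (Fin 4)) ∩ g ⁻¹' G).ncard + (({0, 2} : Set (Fin 4)) ∩ h ⁻¹' G).ncard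
        = rk M G
    · right
      intro B hB
      obtain ⟨J, K, hJ, hK, rfl⟩ := H.isBase_iff.1 hB
      rw [Tight, H.ncard_inter]
      by_cases hJ' : J = {2, 3}
      · subst hJ'
        have h1 := hcd _ K mw2Base_zero_two hK h02
        have h2 := hcd _ _ mw2Base_zero_two mw2Base_zero_two h02
        omega
      · exact hcd J K hJ hK hJ'
    · left
      intro B hB hT
      obtain ⟨J, K, hJ, hK, rfl⟩ := H.isBase_iff.1 hB
      rw [H.tight_left_iff hJ]
      rintro rfl
      rw [Tight, H.ncard_inter] at hT
      have h1 := hcd _ K mw2Base_zero_two hK h02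
      have h2 := hcd _ _ mw2Base_zero_two mw2Base_zero_two h02
      omega

lemma combFlacet_left (H : S0Labelling M g h) : CombFlacet M (g '' {0, 1}) := by
  have := H.finite
  refine ⟨H.isFlat_left, H.combFacet_left, fun F' hF' hT hs => ?_⟩
  have hbase : ∀ {J : Set (Fin 4)}, MW2Base J → M.IsBase (g '' J ∪ h '' {0, 2}) :=
    fun hJ => H.isBase_iff.2 ⟨_, _, hJ, mw2Base_zero_two, rfl⟩
  have hinter : ∀ {J K : Set (Fin 4)},
      ((g '' J ∪ h '' K) ∩ F').ncard = (J ∩ g ⁻¹' F').ncard := by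
    intro J K
    have : h ⁻¹' F' = ∅ := by
      refine eq_empty_of_forall_notMem fun k hk => ?_
      exact H.disjoint.le_bot ⟨image_subset_range _ _ (hs hk), mem_range_self k⟩
    rw [H.ncard_inter, this, inter_empty, ncard_empty, add_zero]
  have htight : ∀ {J : Set (Fin 4)}, MW2Base J → J ≠ {2, 3} →
      (J ∩ g ⁻¹' F').ncard = rk M F' := by
    intro J hJ hne
    rw [← hinter (K := {0, 2})]
    exact (hT _ (hbase hJ)).2 ((H.tight_left_iff hJ).2 hne)
  have h2 : g 2 ∉ F' := fun h2 => by
    have := hs h2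
    rw [H.inj_left.mem_set_image] at this
    simp at this
  have h3 : g 3 ∉ F' := fun h2 => by
    have := hs h2
    rw [H.inj_left.mem_set_image] at this
    simp at this
  have e0 := htight mw2Base_zero_two (by simp [Set.ext_iff, Fin.forall_fin_succ])
  have e1 := htight mw2Base_one_two (by simp [Set.ext_iff, Fin.forall_fin_succ])
  have hsing : ∀ (i j : Fin 4), g i ∈ F' → g j ∉ F' → (({i, j} : Set (Fin 4)) ∩ g ⁻¹' F') = {i} := by
    intro i j hi hj
    rw [insert_inter_of_mem (by exact hi), singleton_inter_eq_empty.2 (by exact hj)]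
    simp
  have hemp : ∀ (i j : Fin 4), g i ∉ F' → g j ∉ F' → (({i, j} : Set (Fin 4)) ∩ g ⁻¹' F') = ∅ := by
    intro i j hi hj
    rw [insert_inter_of_notMem (by exact hi), singleton_inter_eq_empty.2 (by exact hj)]
  refine Subset.antisymm hs ?_
  rintro _ ⟨i, hi, rfl⟩
  -- The bases `{0, 2}` and `{1, 2}` must meet `F'` equally, so `F'` contains both parallel elements
  -- or neither; in the latter case it has rank `0` and `{2, 3}` would be tight as well.
  by_cases h0 : g 0 ∈ F' <;> by_cases h1 : g 1 ∈ F'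
  · rcases hi with rfl | rfl <;> assumption
  · rw [hsing _ _ h0 h2, ncard_singleton] at e0
    rw [hemp _ _ h1 h2, ncard_empty] at e1
    omega
  · rw [hsing _ _ h1 h2, ncard_singleton] at e1
    rw [hemp _ _ h0 h2, ncard_empty] at e0
    omega
  · exfalso
    rw [hemp _ _ h0 h2, ncard_empty] at e0
    have h23 := (hT _ (hbase mw2Base_two_three)).not.2
      ((H.tight_left_iff mw2Base_two_three).not.2 (by simp))
    rw [Tight, hinter, hemp _ _ h2 h3, ncard_empty] at h23
    exact h23 e0

/-- The witness is the midpoint of two complementary bases, each tight on both parallel pairs; all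
its coordinates are `1/2`. -/
lemma not_isSplitMatroid (H : S0Labelling M g h) : ¬ IsSplitMatroid M := by
  have := H.finite
  have hB₁ := H.isBase_iff.2 ⟨_, _, mw2Base_zero_two, mw2Base_zero_two, rfl⟩
  have hB₂ := H.isBase_iff.2 ⟨_, _, mw2Base_one_three, mw2Base_one_three, rfl⟩
  have n02 : ({0, 2} : Set (Fin 4)) ≠ {2, 3} := by simp [Set.ext_iff, Fin.forall_fin_succ]
  have n13 : ({1, 3} : Set (Fin 4)) ≠ {2, 3} := by simp [Set.ext_iff, Fin.forall_fin_succ]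
  have hmid : ∀ {C : Set (M.E → ℝ)}, Convex ℝ C → baseVec M (g '' {0, 2} ∪ h '' {0, 2}) ∈ C →
      baseVec M (g '' {1, 3} ∪ h '' {1, 3}) ∈ C →
      (1 / 2 : ℝ) • baseVec M (g '' {0, 2} ∪ h '' {0, 2}) +
        (1 / 2 : ℝ) • baseVec M (g '' {1, 3} ∪ h '' {1, 3}) ∈ C :=
    fun hC h1 h2 => hC h1 h2 (by norm_num) (by norm_num) (by norm_num)
  have hval : ∀ e : M.E, ((1 / 2 : ℝ) • baseVec M (g '' {0, 2} ∪ h '' {0, 2}) +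
        (1 / 2 : ℝ) • baseVec M (g '' {1, 3} ∪ h '' {1, 3})) e = 1 / 2 := by
    have h4 : ∀ i : Fin 4, (i ∈ ({0, 2} : Set (Fin 4)) ∧ i ∉ ({1, 3} : Set (Fin 4))) ∨
        (i ∉ ({0, 2} : Set (Fin 4)) ∧ i ∈ ({1, 3} : Set (Fin 4))) := by
      intro i; fin_cases i <;> simp
    have hex : ∀ e : M.E,
        ((e : α) ∈ g '' {0, 2} ∪ h '' {0, 2} ∧ (e : α) ∉ g '' {1, 3} ∪ h '' {1, 3}) ∨
        ((e : α) ∉ g '' {0, 2} ∪ h '' {0, 2} ∧ (e : α) ∈ g '' {1, 3} ∪ h '' {1, 3}) := by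
      rintro ⟨e, he⟩
      rcases H.ground_eq.subset he with ⟨i, rfl⟩ | ⟨i, rfl⟩
      · simp only [H.left_mem_iff]; exact h4 i
      · simp only [H.right_mem_iff]; exact h4 i
    intro e
    rw [Pi.add_apply, Pi.smul_apply, Pi.smul_apply]
    rcases hex e with ⟨h1, h2⟩ | ⟨h1, h2⟩
    · rw [baseVec_of_mem h1, baseVec_of_notMem h2]; norm_num
    · rw [baseVec_of_notMem h1, baseVec_of_mem h2]; norm_num
  refine not_isSplitMatroid_iff.2 ⟨g '' {0, 1}, h '' {0, 1}, _, fun he => ?_, H.combFlacet_left,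
    H.symm.combFlacet_left, mem_intrinsicInterior_slab (hmid (AffineSubspace.convex _)
      (subset_affineSpan ℝ _ (baseVec_mem hB₁)) (subset_affineSpan ℝ _ (baseVec_mem hB₂)))
      (fun e _ _ _ => ?_) (fun e _ _ _ => ?_),
    hmid (convex_setOf_hyperplane _) ?_ ?_, hmid (convex_setOf_hyperplane _) ?_ ?_⟩
  · exact H.disjoint.le_bot ⟨mem_range_self 0, image_subset_range h {0, 1} (he ▸ ⟨0, by simp, rfl⟩)⟩
  · rw [hval]; norm_num
  · rw [hval]; norm_num
  · rw [baseVec_mem_hyperplane_iff hB₁, H.tight_left_iff mw2Base_zero_two]; exact n02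
  · rw [baseVec_mem_hyperplane_iff hB₂, H.tight_left_iff mw2Base_one_three]; exact n13
  · rw [baseVec_mem_hyperplane_iff hB₁, union_comm, H.symm.tight_left_iff mw2Base_zero_two]
    exact n02
  · rw [baseVec_mem_hyperplane_iff hB₂, union_comm, H.symm.tight_left_iff mw2Base_one_three]
    exact n13

lemma splits (H : S0Labelling M g h) : Splits M M.E (range g) := by
  intro I J hI hJ hIg hJE hd
  have h1 := H.exists_eq hI.subset_ground
  have h2 := H.exists_eq hJ.subset_ground
  have hh : h ⁻¹' I = ∅ := eq_empty_of_forall_notMem fun k hk =>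
    H.disjoint.le_bot ⟨hIg hk, mem_range_self k⟩
  have hg : g ⁻¹' J = ∅ := eq_empty_of_forall_notMem fun k hk =>
    hd.le_bot ⟨hk, mem_range_self k⟩
  rw [hh, image_empty, union_empty] at h1
  rw [hg, image_empty, empty_union] at h2
  rw [h1, h2, H.indep_iff]
  constructor
  · exact ((H.indep_iff _ ∅).1 (by rwa [image_empty, union_empty, ← h1])).1
  · exact ((H.indep_iff ∅ _).1 (by rwa [image_empty, empty_union, ← h2])).2

lemma not_isConnected (H : S0Labelling M g h) : ¬ IsConnected M := by
  have := H.finite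
  refine H.splits.not_isConnected (e := g 0) (f := h 0) ?_ ?_ (mem_range_self 0)
    fun hg => H.disjoint.le_bot ⟨hg, mem_range_self 0⟩
  · rw [H.ground_eq]; exact Or.inl (mem_range_self 0)
  · rw [H.ground_eq]; exact Or.inr (mem_range_self 0)

end S0Labelling

/-! ### Identification of labellings with isomorphisms to `S₀` -/

lemma uniform_indep_iff {k : ℕ} {ι : Type*} [Finite ι] {I : Set ι} :
    (uniform k ι).Indep I ↔ I.ncard ≤ k := Iff.rfl

lemma MW2_indep_iff {J : Set (Fin 4)} : MW2.Indep J ↔ MW2Indep J := by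
  rw [MW2, Matroid.comap_indep_iff, uniform_indep_iff]
  lift J to Finset (Fin 4) using J.toFinite
  have key : ∀ J : Finset (Fin 4), (J.image ![(0 : Fin 3), 0, 1, 2]).card ≤ 2 ∧
      (∀ i ∈ J, ∀ j ∈ J, ![(0 : Fin 3), 0, 1, 2] i = ![(0 : Fin 3), 0, 1, 2] j → i = j) ↔
      (¬ (0 ∈ J ∧ 1 ∈ J) ∧ ¬ (0 ∈ J ∧ 2 ∈ J ∧ 3 ∈ J) ∧ ¬ (1 ∈ J ∧ 2 ∈ J ∧ 3 ∈ J)) := by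
    decide
  rw [← Finset.coe_image, ncard_coe_finset]
  refine Iff.trans (and_congr_right' ?_) (key J)
  exact ⟨fun h i hi j hj e => h hi hj e, fun h i hi j hj e => h i hi j hj e⟩

lemma S0_ground : S0.E = univ := by
  rw [S0, Matroid.sum_ground]
  ext x
  rcases x with x | x <;> simp [MW2, uniform]

lemma S0_indep_iff {I : Set (Fin 4 ⊕ Fin 4)} :
    S0.Indep I ↔ MW2Indep (Sum.inl ⁻¹' I) ∧ MW2Indep (Sum.inr ⁻¹' I) := by
  rw [S0, Matroid.sum_indep_iff, MW2_indep_iff, MW2_indep_iff]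

lemma isomorphic_S0_iff : Isomorphic M S0 ↔ ∃ g h, S0Labelling M g h := by
  have hE : ∀ x, x ∈ S0.E := fun x => S0_ground ▸ mem_univ x
  constructor
  · rintro ⟨f, hf⟩
    set φ : Fin 4 ⊕ Fin 4 → α := fun x => f.symm ⟨x, hE x⟩ with hφ
    have hinj : Function.Injective φ := fun x y hxy => by
      simpa using f.symm.injective (Subtype.ext hxy)
    refine ⟨φ ∘ Sum.inl, φ ∘ Sum.inr, hinj.comp Sum.inl_injective, hinj.comp Sum.inr_injective,
      ?_, ?_, fun J K => ?_⟩
    · rw [disjoint_left]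
      rintro _ ⟨i, rfl⟩ ⟨j, hj⟩
      simpa using hinj hj
    · ext e
      constructor
      · intro he
        have h1 : φ (f ⟨e, he⟩) = e := by simp [hφ]
        rw [← h1]
        rcases ((f ⟨e, he⟩ : S0.E) : Fin 4 ⊕ Fin 4) with i | i
        · exact Or.inl ⟨i, rfl⟩
        · exact Or.inr ⟨i, rfl⟩
      · rintro (⟨i, rfl⟩ | ⟨i, rfl⟩) <;> exact Subtype.coe_prop _
    · rw [image_comp, image_comp, ← image_union]
      have h1 : φ '' (Sum.inl '' J ∪ Sum.inr '' K) =
          (↑) '' (f.symm '' ((↑) ⁻¹' (Sum.inl '' J ∪ Sum.inr '' K) : Set S0.E)) := by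
        ext e
        simp only [hφ, mem_image, mem_preimage]
        constructor
        · rintro ⟨x, hx, rfl⟩; exact ⟨_, ⟨⟨x, hE x⟩, hx, rfl⟩, rfl⟩
        · rintro ⟨_, ⟨x, hx, rfl⟩, rfl⟩; exact ⟨x, hx, rfl⟩
      rw [h1, hf, Equiv.image_symm_image, Subtype.image_preimage_coe,
        inter_eq_self_of_subset_right (fun x _ => hE x), S0_indep_iff]
      simp [preimage_union, preimage_image_eq _ Sum.inl_injective,
        preimage_image_eq _ Sum.inr_injective]
  · rintro ⟨g, h, H⟩
    have hgh : ∀ x, Sum.elim g h x ∈ M.E := by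
      rw [H.ground_eq]
      rintro (i | i)
      · exact Or.inl ⟨i, rfl⟩
      · exact Or.inr ⟨i, rfl⟩
    have hinj : Function.Injective (Sum.elim g h) :=
      H.inj_left.sumElim H.inj_right fun i j hij =>
        H.disjoint.le_bot ⟨mem_range_self i, hij ▸ mem_range_self j⟩
    let e : S0.E ≃ M.E := Equiv.ofBijective (fun x => ⟨Sum.elim g h x, hgh x⟩)
      ⟨fun x y hxy => Subtype.ext (hinj (congrArg (fun z : M.E => (z : α)) hxy)), by
        rintro ⟨y, hy⟩
        rcases H.ground_eq.subset hy with ⟨i, rfl⟩ | ⟨i, rfl⟩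
        · exact ⟨⟨Sum.inl i, hE _⟩, rfl⟩
        · exact ⟨⟨Sum.inr i, hE _⟩, rfl⟩⟩
    have he : ∀ x, (e ⟨x, hE x⟩ : α) = Sum.elim g h x := fun x => rfl
    refine ⟨e.symm, fun I => ?_⟩
    have hmem : ∀ x, x ∈ ((↑) '' (e.symm '' I) : Set (Fin 4 ⊕ Fin 4)) ↔
        Sum.elim g h x ∈ ((↑) '' I : Set α) := by
      intro x
      rw [← he, Subtype.val_injective.mem_set_image, e.symm.image_eq_preimage_symm]
      constructor
      · rintro ⟨y, hy, rfl⟩; exact hy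
      · intro hx; exact ⟨⟨x, hE x⟩, hx, rfl⟩
    rw [H.exists_eq (I := (↑) '' I) (by rintro _ ⟨y, -, rfl⟩; exact y.2), H.indep_iff,
      S0_indep_iff]
    refine and_congr (iff_of_eq (congrArg _ ?_)) (iff_of_eq (congrArg _ ?_))
    · ext i; exact (hmem (Sum.inl i)).symm
    · ext i; exact (hmem (Sum.inr i)).symm

/-! ### Minors and the classification -/

lemma Splits.isMinor (h : Splits M M.E S) {N : Matroid α} (hN : N.IsMinor M) :
    Splits N N.E S := by
  obtain ⟨C, D, rfl⟩ := hN
  obtain ⟨C₀, hC₀⟩ := M.exists_isBasis' C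
  intro I J hI hJ hIS _ hd
  rw [Matroid.delete_indep_iff, hC₀.contract_indep_iff] at *
  refine ⟨⟨?_, disjoint_union_right.2 ⟨hI.1.2, hJ.1.2⟩⟩, disjoint_union_left.2 ⟨hI.2, hJ.2⟩⟩
  -- The basis `C₀` of the contracted set is itself cut along `S`, one part joining `I` and the
  -- other `J`.
  have h1 : M.Indep (I ∪ (C₀ ∩ S)) :=
    hI.1.1.subset (union_subset_union_right _ inter_subset_left)
  have h2 : M.Indep (J ∪ (C₀ \ S)) :=
    hJ.1.1.subset (union_subset_union_right _ sdiff_subset)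
  have h3 := h h1 h2 (union_subset hIS inter_subset_right) h2.subset_ground
    (disjoint_union_left.2 ⟨hd, disjoint_sdiff_left⟩)
  rwa [union_union_union_comm, inter_union_sdiff] at h3

lemma CombFlacet.exists_splits [M.Finite] (hF : CombFlacet M F) (hS : Splits M M.E S) :
    F \ M.loops ⊆ S ∨ F \ M.loops ⊆ M.E \ S :=
  (hF.subset_or_disjoint hS).imp_right fun hd _ hx =>
    ⟨hF.isFlat.subset_ground hx.1, fun hxS => hd.le_bot ⟨hx, hxS⟩⟩

lemma CombFlacet.four_le_ncard [M.Finite] (hF : CombFlacet M F) (hnt : (F \ M.loops).Nontrivial)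
    (hS : Splits M M.E S) (hFS : F \ M.loops ⊆ S) : 4 ≤ (S ∩ M.E).ncard := by
  obtain ⟨g, -, hg, hgS, -⟩ := hF.exists_MW2 hnt hS hFS
  have := ncard_le_ncard hgS (M.ground_finite.subset inter_subset_right)
  rwa [← image_univ, ncard_image_of_injective _ hg, ncard_univ, Nat.card_fin] at this

/-- With at most four elements available, the minor from `exists_MW2` uses all of them and nothing
is contracted. So `S ∩ M.E` carries `M(𝒲₂)` itself, whose only dependent pair is the flacet without
loops. -/
lemma CombFlacet.exists_pair [M.Finite] (hF : CombFlacet M F) (hnt : (F \ M.loops).Nontrivial)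
    (hS : Splits M M.E S) (hFS : F \ M.loops ⊆ S) (hc : (S ∩ M.E).ncard ≤ 4) :
    ∃ a b, a ≠ b ∧ F \ M.loops = {a, b} ∧ ¬ M.Indep {a, b} ∧
      ∀ c ∈ S ∩ M.E, ∀ d ∈ S ∩ M.E, c ≠ d → ¬ M.Indep {c, d} → ({c, d} : Set α) = {a, b} := by
  obtain ⟨g, Z, hg, hgS, hZS, hZ, h0, h1, h2, h3, hind⟩ := hF.exists_MW2 hnt hS hFS
  have hcard : (range g).ncard = 4 := by
    rw [← image_univ, ncard_image_of_injective _ hg, ncard_univ, Nat.card_fin]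
  have hr : range g = S ∩ M.E := eq_of_subset_of_ncard_le hgS (by rwa [hcard])
    (M.ground_finite.subset inter_subset_right)
  obtain rfl : Z = ∅ := by
    rw [← hr] at hZS
    exact disjoint_self.1 (hZ.mono_right hZS)
  simp only [union_empty] at hind
  refine ⟨g 0, g 1, hg.ne (by decide), ?_, ?_, ?_⟩
  · refine Subset.antisymm (fun x hx => ?_) (pair_subset h0 h1)
    obtain ⟨i, rfl⟩ := hr.symm.subset ⟨hFS hx, hF.isFlat.subset_ground hx.1⟩
    fin_cases i
    exacts [Or.inl rfl, Or.inr rfl, absurd hx.1 h2, absurd hx.1 h3]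
  · rw [← image_pair, hind]
    simp [MW2Indep]
  · rw [← hr]
    rintro _ ⟨i, rfl⟩ _ ⟨j, rfl⟩ hij hni
    rw [← image_pair, hind] at hni
    rw [← image_pair, ← image_pair]
    by_contra hne
    exact hni (mw2Base_pair (fun h => hij (congrArg g h)) fun h => hne (congrArg (g '' ·) h)).1

lemma CombFlacet.eq_of_ncard_le [M.Finite] {F₁ F₂ : Set α} (h₁ : CombFlacet M F₁)
    (h₂ : CombFlacet M F₂) (hnt₁ : (F₁ \ M.loops).Nontrivial) (hnt₂ : (F₂ \ M.loops).Nontrivial)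
    (hS : Splits M M.E S) (hs₁ : F₁ \ M.loops ⊆ S) (hs₂ : F₂ \ M.loops ⊆ S)
    (hc : (S ∩ M.E).ncard ≤ 4) : F₁ = F₂ := by
  obtain ⟨a, b, -, hab, -, huniq⟩ := h₁.exists_pair hnt₁ hS hs₁ hc
  obtain ⟨c, d, hcd, hcd', hdep, -⟩ := h₂.exists_pair hnt₂ hS hs₂ hc
  have hm : ∀ x ∈ F₂ \ M.loops, x ∈ S ∩ M.E := fun x hx =>
    ⟨hs₂ hx, h₂.isFlat.subset_ground hx.1⟩
  have := huniq c (hm c (by simp [hcd'])) d (hm d (by simp [hcd'])) hcd hdep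
  rw [← sdiff_union_of_subset h₁.isFlat.loops_subset, hab, ← this, ← hcd',
    sdiff_union_of_subset h₂.isFlat.loops_subset]

/-- A proper minor has at most seven elements, so flacets on different sides, needing four each, do
not fit. Flacets on one side coincide by uniqueness of the parallel pair. -/
lemma S0Labelling.isSplitMatroid_of_isStrictMinor {g h : Fin 4 → α} (H : S0Labelling M g h)
    {N : Matroid α} (hN : N.IsStrictMinor M) : IsSplitMatroid N := by
  have := H.finite
  have hNf : N.Finite := ⟨M.ground_finite.subset hN.ssubset.subset⟩
  by_contra hcon
  obtain ⟨F₁, F₂, x, hne, h₁, h₂, hx, hx₁, hx₂⟩ := not_isSplitMatroid_iff.1 hcon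
  have hnt₁ := h₁.nontrivial_of_mem_intrinsicInterior hx hx₁
  have hnt₂ := h₂.nontrivial_of_mem_intrinsicInterior hx hx₂
  have hcard : ∀ {k : Fin 4 → α}, Function.Injective k → (range k).ncard = 4 := fun hk => by
    rw [← image_univ, ncard_image_of_injective _ hk, ncard_univ, Nat.card_fin]
  have hlt := ncard_lt_ncard hN.ssubset M.ground_finite
  rw [H.ground_eq, ncard_union_eq H.disjoint (finite_range g) (finite_range h),
    hcard H.inj_left, hcard H.inj_right] at hlt
  have hS := H.splits.isMinor hN.isMinor
  have hT := hS.compl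
  have hSc : (range g ∩ N.E).ncard ≤ 4 :=
    (ncard_le_ncard inter_subset_left (finite_range g)).trans_eq (hcard H.inj_left)
  have hTc : ((N.E \ range g) ∩ N.E).ncard ≤ 4 := by
    refine (ncard_le_ncard (fun x hx => ?_) (finite_range h)).trans_eq (hcard H.inj_right)
    exact (H.ground_eq.subset (hN.ssubset.subset hx.2)).resolve_left hx.1.2
  have hsum : (range g ∩ N.E).ncard + ((N.E \ range g) ∩ N.E).ncard = N.E.ncard := by
    rw [inter_eq_self_of_subset_left sdiff_subset, inter_comm]
    exact ncard_inter_add_ncard_sdiff_eq_ncard _ _ N.ground_finite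
  have hdiff : ∀ {F F'}, CombFlacet N F → CombFlacet N F' → (F \ N.loops).Nontrivial →
      (F' \ N.loops).Nontrivial → F \ N.loops ⊆ range g → F' \ N.loops ⊆ N.E \ range g →
      False := by
    intro F F' hF hF' hn hn' hs hs'
    have := hF.four_le_ncard hn hS hs
    have := hF'.four_le_ncard hn' hT hs'
    omega
  rcases h₁.exists_splits hS with hs₁ | hs₁ <;> rcases h₂.exists_splits hS with hs₂ | hs₂
  · exact hne (h₁.eq_of_ncard_le h₂ hnt₁ hnt₂ hS hs₁ hs₂ hSc)
  · exact hdiff h₁ h₂ hnt₁ hnt₂ hs₁ hs₂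
  · exact hdiff h₂ h₁ hnt₂ hnt₁ hs₂ hs₁
  · exact hne (h₁.eq_of_ncard_le h₂ hnt₁ hnt₂ hT hs₁ hs₂ hTc)

lemma restrict_isMinor (hS : S ⊆ M.E) : (M ↾ S).IsMinor M :=
  ⟨∅, M.E \ S, by rw [Matroid.contract_empty, Matroid.delete_compl hS]⟩

lemma restrict_isStrictMinor (hS : S ⊂ M.E) : (M ↾ S).IsStrictMinor M :=
  Matroid.isStrictMinor_iff_isMinor_ssubset.2
    ⟨restrict_isMinor hS.subset, hS⟩

/-- Flacets on different sides of a separator produce a minor isomorphic to `S₀`. -/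
lemma exists_isMinor_S0Labelling [M.Finite] {F₁ F₂ : Set α} (h₁ : CombFlacet M F₁)
    (h₂ : CombFlacet M F₂) (hnt₁ : (F₁ \ M.loops).Nontrivial) (hnt₂ : (F₂ \ M.loops).Nontrivial)
    (hS : Splits M M.E S) (hs₁ : F₁ \ M.loops ⊆ S) (hs₂ : F₂ \ M.loops ⊆ M.E \ S) :
    ∃ N g h, N.IsMinor M ∧ S0Labelling N g h := by
  obtain ⟨g, Z₁, hg, hgS, hZS, hZg, -, -, -, -, hind₁⟩ := h₁.exists_MW2 hnt₁ hS hs₁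
  obtain ⟨h, Z₂, hh, hhT, hZT, hZh, -, -, -, -, hind₂⟩ := h₂.exists_MW2 hnt₂ hS.compl hs₂
  have hST : Disjoint (S ∩ M.E) ((M.E \ S) ∩ M.E) :=
    disjoint_left.2 fun x hx hx' => hx'.1.2 hx.1
  have hdisj : Disjoint (range g ∪ range h) (Z₁ ∪ Z₂) := by
    rw [disjoint_union_left, disjoint_union_right, disjoint_union_right]
    exact ⟨⟨hZg.symm, hST.mono hgS hZT⟩, (hST.mono hZS hhT).symm, hZh.symm⟩
  have hsplit : ∀ J K : Set (Fin 4), M.Indep (g '' J ∪ h '' K ∪ (Z₁ ∪ Z₂)) ↔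
      MW2Indep J ∧ MW2Indep K := by
    intro J K
    rw [← hind₁, ← hind₂, union_union_union_comm]
    constructor
    · exact fun hi => ⟨hi.subset subset_union_left, hi.subset subset_union_right⟩
    · rintro ⟨hi, hi'⟩
      refine hS hi hi' ?_ hi'.subset_ground ?_
      · exact union_subset ((image_subset_range _ _).trans (hgS.trans inter_subset_left))
          (hZS.trans inter_subset_left)
      · exact disjoint_left.2 fun x hx hxS =>
          ((union_subset ((image_subset_range _ _).trans hhT) hZT) hx).1.2 hxS
  -- The case of empty `J` and `K`. Independence of the contracted set makes independence in the
  -- contraction a condition on unions in `M`.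
  have hZ : M.Indep (Z₁ ∪ Z₂) := by
    have := (hsplit ∅ ∅).2 ⟨by simp [MW2Indep], by simp [MW2Indep]⟩
    simpa using this
  have hsub : range g ∪ range h ⊆ (M ／ (Z₁ ∪ Z₂)).E := by
    rw [Matroid.contract_ground, subset_sdiff]
    exact ⟨union_subset (hgS.trans inter_subset_right) (hhT.trans inter_subset_right), hdisj⟩
  refine ⟨(M ／ (Z₁ ∪ Z₂)) ↾ (range g ∪ range h), g, h,
    (restrict_isMinor hsub).trans ⟨Z₁ ∪ Z₂, ∅, (Matroid.delete_empty _).symm⟩,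
    hg, hh, hST.mono hgS hhT, rfl, fun J K => ?_⟩
  have hJK : g '' J ∪ h '' K ⊆ range g ∪ range h :=
    union_subset_union (image_subset_range _ _) (image_subset_range _ _)
  rw [Matroid.restrict_indep_iff, hZ.contract_indep_iff, and_iff_left hJK,
    and_iff_right (hdisj.mono_left hJK), hsplit]

lemma IsExcludedMinor.exists_S0Labelling [M.Finite] (hM : IsExcludedMinor M)
    (hc : ¬ IsConnected M) : ∃ g h, S0Labelling M g h := by
  obtain ⟨S, hSE, hSne, hSE', hS⟩ := exists_splits_of_not_isConnected hc
  obtain ⟨F₁, F₂, x, hne, h₁, h₂, hx, hx₁, hx₂⟩ := not_isSplitMatroid_iff.1 hM.1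
  have hnt₁ := h₁.nontrivial_of_mem_intrinsicInterior hx hx₁
  have hnt₂ := h₂.nontrivial_of_mem_intrinsicInterior hx hx₂
  -- Both flacets inside a proper separator would make the restriction to it a strict minor that is
  -- not split.
  have hsame : ∀ {T : Set α}, T ⊂ M.E → Splits M M.E T → F₁ \ M.loops ⊆ T →
      F₂ \ M.loops ⊆ T → False := fun hT hT' hs₁ hs₂ =>
    not_isSplitMatroid_restrict hT.subset hT' hne h₁ h₂ hx hx₁ hx₂ hs₁ hs₂
      (hM.2 _ (restrict_isStrictMinor hT))
  have hfin : (∃ N g h, N.IsMinor M ∧ S0Labelling N g h) → ∃ g h, S0Labelling M g h := by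
    rintro ⟨N, g, h, hN, H⟩
    by_cases hNM : N = M
    · exact ⟨g, h, hNM ▸ H⟩
    · exact absurd (hM.2 N (Matroid.isStrictMinor_iff_isMinor_ne.2 ⟨hN, hNM⟩)) H.not_isSplitMatroid
  rcases h₁.exists_splits hS with hs₁ | hs₁ <;> rcases h₂.exists_splits hS with hs₂ | hs₂
  · exact (hsame (hSE.ssubset_of_ne hSE') hS hs₁ hs₂).elim
  · exact hfin (exists_isMinor_S0Labelling h₁ h₂ hnt₁ hnt₂ hS hs₁ hs₂)
  · exact hfin (exists_isMinor_S0Labelling h₂ h₁ hnt₂ hnt₁ hS hs₂ hs₁)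
  · refine (hsame (sdiff_subset.ssubset_of_ne fun he => ?_) hS.compl hs₁ hs₂).elim
    obtain ⟨e, he'⟩ := hSne
    exact (he.symm.subset (hSE he')).2 he'

end SplitMatroid

theorem mainTheorem3 {α : Type*} (M : Matroid α) [M.Finite] :
    (SplitMatroid.IsExcludedMinor M ∧ ¬ SplitMatroid.IsConnected M) ↔
      SplitMatroid.Isomorphic M SplitMatroid.S0 := by
  rw [SplitMatroid.isomorphic_S0_iff]
  constructor
  · rintro ⟨hM, hc⟩
    exact hM.exists_S0Labelling hc
  · rintro ⟨g, h, H⟩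
    exact ⟨⟨H.not_isSplitMatroid, fun N hN => H.isSplitMatroid_of_isStrictMinor hN⟩,
      H.not_isConnected⟩
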